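/- Let $\Sigma$ be an alphabet with a letter $\$\in\Sigma$. A string terminates with the unique end-marker $\$$ if its last letter is $\$$ and $\$$ occurs nowhere else in it. For such a string $T$: - A substring $x$ of $T$ is *right-maximal* if $xa$ and $xb$ are substrings of $T$ for two distinct letters $a,b$, or $x$ is a suffix of $T$; it is *left-maximal* if $ax$ and $bx$ are substrings of $T$ for two distinct letters $a,b$, or $x$ is a prefix of $T$; it is *maximal* if it is both. - The suffix tree of $T$ has the right-maximal substrings as nodes, and an edge labeled $\beta\neq\varepsilon$ from $u$ to $u\beta$ whenever $u$ and $u\beta$ are nodes and no node lies strictly between them, i.e. $u\gamma$ is not a node for any non-empty proper prefix $\gamma$ of $\beta$. The compact directed acyclic word graph $\mathrm{CDAWG}(T)$ is the edge-labeled directed acyclic graph obtained from the suffix tree by merging isomorphic subtrees. Each of its nodes is identified with the longest string it represents; the nodes are then exactly the maximal substrings of $T$, the source is $\varepsilon$ and the sink is $T$. Let $e(T)$ be the number of edges of $\mathrm{CDAWG}(T)$. - The *CDAWG-grammar* of $T$ is obtained as follows. Take a nonterminal $F_v$ for every non-source node $v$ of $\mathrm{CDAWG}(T)$, with start symbol $F_T$.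 The rule of $F_v$ has on its right-hand side one symbol for each edge $(x,\beta,v)$ entering $v$, in the order of decreasing $|x|+|\beta|$: the first letter of $\beta$ if $x=\varepsilon$, and $F_x$ otherwise. Then every rule with a single symbol on its right-hand side is removed, its left-hand side being replaced by that symbol in all other rules. Let $g(T)$ be the size of the resulting grammar, i.e. the total length of the right-hand sides of its rules. (For $T=\$$ no rule is left and $g(T)=0$.) **Theorem.** Let $T$ and $T'$ be strings over $\Sigma$ that both terminate with the unique end-marker $\$$, and let $T'$ be obtained from $T$ by the insertion, deletion or substitution of a single character. Then $$g(T')-g(T)\le 4\,e(T)+4 .$$ -/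

import Mathlib

namespace CDAWG

variable {α : Type*}

/-- `T` terminates with the unique end-marker `d`. -/
def EndsUniquely (d : α) (T : List α) : Prop :=
  ∃ u : List α, d ∉ u ∧ T = u ++ [d]

/-- `T'` arises from `T` by inserting, deleting or substituting one character. -/
inductive SingleEdit : List α → List α → Prop
  | insertion (p s : List α) (a : α) : SingleEdit (p ++ s) (p ++ a :: s)
  | deletion (p s : List α) (a : α) : SingleEdit (p ++ a :: s) (p ++ s)
  | substitution (p s : List α) (a b : α) (hab : a ≠ b) :
      SingleEdit (p ++ a :: s) (p ++ b :: s)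

def LeftMaximal (T x : List α) : Prop :=
  x <:+: T ∧ ((∃ a b : α, a ≠ b ∧ (a :: x) <:+: T ∧ (b :: x) <:+: T) ∨ x <+: T)

def RightMaximal (T x : List α) : Prop :=
  x <:+: T ∧ ((∃ a b : α, a ≠ b ∧ (x ++ [a]) <:+: T ∧ (x ++ [b]) <:+: T) ∨ x <:+ T)

def MaximalSubstring (T x : List α) : Prop :=
  LeftMaximal T x ∧ RightMaximal T x

/-- The nodes of the suffix tree of `T` are the right-maximal substrings of `T`;
`SuffixTreeEdge T u β` says that it has an edge labeled `β` from `u` to its child `u ++ β`. -/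
def SuffixTreeEdge (T u β : List α) : Prop :=
  RightMaximal T u ∧ β ≠ [] ∧ RightMaximal T (u ++ β) ∧
    ∀ γ : List α, γ <+: β → γ ≠ [] → RightMaximal T (u ++ γ) → γ = β

/-- The subtrees of the suffix tree of `T` rooted at the nodes `u` and `v` are isomorphic as
edge-labeled trees: the same label sequences lead from `u` and from `v` to descendants. -/
def SubtreeIso (T u v : List α) : Prop :=
  ∀ w : List α, RightMaximal T (u ++ w) ↔ RightMaximal T (v ++ w)

/-- The nodes of the CDAWG of `T`, i.e. the classes of suffix tree nodes with isomorphic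
subtrees, each class being represented by its longest member, a maximal substring of `T`.
The source is `[]` and the sink is `T`. -/
def nodes (T : List α) : Set (List α) :=
  {x | MaximalSubstring T x}

/-- The labeled edges of the CDAWG of `T`: a triple `(x, β, y)` is an edge with label `β` from
node `x` to node `y`, where `y` represents the class of the child `x ++ β` of `x`. -/
def edges (T : List α) : Set (List α × List α × List α) :=
  {e | e.1 ∈ nodes T ∧ e.2.2 ∈ nodes T ∧
    SuffixTreeEdge T e.1 e.2.1 ∧ SubtreeIso T (e.1 ++ e.2.1) e.2.2}

/-- The number of edges of the CDAWG of `T`. -/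
noncomputable def size (T : List α) : ℕ :=
  (edges T).ncard

theorem finite_infix (T : List α) : {x : List α | x <:+: T}.Finite :=
  (List.finite_toSet T.sublists).subset fun _ hx => List.mem_sublists.2 hx.sublist

theorem nodes_finite (T : List α) : (nodes T).Finite :=
  (finite_infix T).subset fun _ hx => hx.1.1

theorem edges_finite (T : List α) : (edges T).Finite :=
  ((finite_infix T).prod ((finite_infix T).prod (finite_infix T))).subset fun _ he =>
    ⟨he.1.1.1, (List.infix_append' _ _ []).trans (by simpa using he.2.2.1.2.2.1.1), he.2.1.1.1⟩

/-- The edges of the CDAWG of `T` that enter the node `v`. -/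
noncomputable def inEdges (T v : List α) : Finset (List α × List α × List α) :=
  ((edges_finite T).subset (Set.sep_subset (edges T) fun e => e.2.2 = v)).toFinset

/-- The grammar symbol contributed by an edge of the CDAWG: an edge that leaves the source
contributes the first character of its label, an edge that leaves another node `x` contributes
the nonterminal of `x`. -/
def edgeSymbol : List α × List α × List α → Symbol α (List α)
  | ([], a :: _, _) => Symbol.terminal a
  | (x, _, _) => Symbol.nonterminal x

/-- The right-hand side of the rule of the non-source node `v` in the grammar whose derivation
tree is the unfolding of the reversed CDAWG. The edges `(x, β, v)` that enter `v` are taken in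
the order of decreasing `|x| + |β|`, which is the left-to-right order in that tree. -/
noncomputable def rhs (T v : List α) : List (Symbol α (List α)) :=
  ((inEdges T v).toList.mergeSort
    fun e f => f.1.length + f.2.1.length ≤ e.1.length + e.2.1.length).map edgeSymbol

open Classical in
/-- The rules of the grammar read off from the reversed CDAWG of `T`: the nonterminals are the
non-source nodes, each with exactly one rule, and the start symbol is the sink `T`. -/
noncomputable def initialGrammar (T : List α) : Finset (ContextFreeRule α (List α)) :=
  ((nodes_finite T).toFinset.erase []).image fun v => ⟨v, rhs T v⟩

/-- Replace a nonterminal whose rule has a single symbol on the right by that symbol. -/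
noncomputable def contract (T : List α) : Symbol α (List α) → Symbol α (List α)
  | Symbol.terminal a => Symbol.terminal a
  | Symbol.nonterminal v =>
    match rhs T v with
    | [s] => s
    | _ => Symbol.nonterminal v

open Classical in
/-- The CDAWG-grammar of `T`: every redundant rule, i.e. every rule with a single symbol on the
right, is removed, and its left-hand side is replaced by that symbol wherever it occurs. Chains
of redundant rules run through shorter and shorter nodes, so `T.length` replacements suffice. -/
noncomputable def grammar (T : List α) : Finset (ContextFreeRule α (List α)) :=
  ((initialGrammar T).filter fun r => r.output.length ≠ 1).image
    fun r => ⟨r.input, r.output.map ((contract T)^[T.length])⟩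

/-- The size of a grammar: the total length of the right-hand sides of its rules. -/
def grammarSize {N : Type*} (G : Finset (ContextFreeRule α N)) : ℕ :=
  ∑ r ∈ G, r.output.length

/-- The size of the CDAWG-grammar of `T`. -/
noncomputable def gsize (T : List α) : ℕ :=
  grammarSize (grammar T)

end CDAWG

/-!
The number of nodes of the CDAWG plus its excess, the sum of `out-degree - 1` over the nodes other
than the sink, is `e(T) + 1`. Every node except the source has an incoming edge and rules of length
one disappear, so `g(T') ≤ 2 * excess T'`, and it suffices to prove `excess T' ≤ 2 * e(T) + 2`.

Write `T = p ++ b ++ s` and `T' = p ++ c ++ s` with `|c| ≤ 1` and `s` nonempty. The contribution of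
a node `x` of `T'` to `excess T'` splits into four parts.
* If `x` is a node of `T`, its right letters in `T` contribute to `excess T`.
* If `x` is left-maximal in `T`, each new right letter follows an occurrence of `x` that starts at
  a position `i` in `p` and ends no earlier than `p` does. The position determines `x` and the
  letter, and the suffix of `p` starting there is left-maximal in `T`. Extending such suffixes to
  the right to maximal substrings is injective, so their number is at most that of the nodes of `T`.
* If `x` occurs in `T` but is not left-maximal there, it occurs in `T'` with a new left context.
  Such an occurrence ends after some prefix of `s`, which determines `x` and has all the right
  letters of `x` as well as the letter following the occurrence. Extending the prefixes of `s` to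
  the left to maximal substrings is injective, so this costs at most `excess T`.
* Every other new letter comes with two occurrences of `x` around the edit that differ on both
  sides. Their distance `D` determines them, and `D - |c|` is the length of a prefix of `s` that is
  a suffix of `p`. Comparing successive such prefixes at their first mismatch gives branching
  prefixes of `s`, so their number is at most the number of nodes of `T`.
The sum is at most `2 * excess T + 2 * #nodes = 2 * e(T) + 2`.
-/

namespace CDAWG

variable {α : Type*}

/-! ### Occurrences and maximal extensions -/

section Occurrences

variable {T x y : List α} {a : α} {i j : ℕ}

/-- `x` occurs in `T` at position `i`. The bound excludes `i > |T|` when `x = []`. -/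
structure OccAt (T x : List α) (i : ℕ) : Prop where
  add_length_le : i + x.length ≤ T.length
  getElem?_add : ∀ k < x.length, T[i + k]? = x[k]?

theorem occAt_append (l x r : List α) : OccAt (l ++ x ++ r) x l.length := by
  refine ⟨by simp, fun k hk => ?_⟩
  rw [List.append_assoc, List.getElem?_append_right (by omega), Nat.add_sub_cancel_left,
    List.getElem?_append_left hk]

theorem OccAt.eq_of_length_eq (hx : OccAt T x i) (hy : OccAt T y i)
    (h : x.length = y.length) : x = y := by
  refine List.ext_getElem? fun k => ?_
  by_cases hk : k < x.length
  · rw [← hx.getElem?_add k hk, ← hy.getElem?_add k (by omega)]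
  · rw [List.getElem?_eq_none (by omega), List.getElem?_eq_none (by omega)]

theorem OccAt.eq_append (h : OccAt T x i) : T = T.take i ++ x ++ T.drop (i + x.length) := by
  have hle := h.add_length_le
  have hT : T = T.take i ++ (T.drop i).take x.length ++ T.drop (i + x.length) := by
    rw [List.append_assoc, ← List.drop_drop, List.take_append_drop, List.take_append_drop]
  have hocc := occAt_append (T.take i) ((T.drop i).take x.length) (T.drop (i + x.length))
  rw [← hT, List.length_take_of_le (by omega)] at hocc
  have hx : (T.drop i).take x.length = x := hocc.eq_of_length_eq h (by simp; omega)
  rwa [hx] at hT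

theorem OccAt.infix (h : OccAt T x i) : x <:+: T :=
  ⟨_, _, h.eq_append.symm⟩

theorem infix_iff_exists_occAt : x <:+: T ↔ ∃ i, OccAt T x i := by
  refine ⟨?_, fun ⟨_, h⟩ => h.infix⟩
  rintro ⟨l, r, rfl⟩
  exact ⟨_, occAt_append l x r⟩

theorem prefix_iff_occAt : x <+: T ↔ OccAt T x 0 := by
  refine ⟨?_, fun h => ⟨_, by simpa using h.eq_append.symm⟩⟩
  rintro ⟨r, rfl⟩
  exact occAt_append [] x r

theorem occAt_append_iff :
    OccAt T (x ++ y) i ↔ OccAt T x i ∧ OccAt T y (i + x.length) := by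
  constructor
  · rintro ⟨hle, h⟩
    rw [List.length_append] at hle h
    refine ⟨⟨by omega, fun k hk => ?_⟩, ⟨by omega, fun k hk => ?_⟩⟩
    · rw [h k (by omega), List.getElem?_append_left hk]
    · rw [add_assoc, h _ (by omega), List.getElem?_append_right (by omega),
        Nat.add_sub_cancel_left]
  · rintro ⟨⟨-, hx⟩, ⟨hle, hy⟩⟩
    refine ⟨by rw [List.length_append]; omega, fun k hk => ?_⟩
    rw [List.length_append] at hk
    by_cases hkx : k < x.length
    · rw [hx k hkx, List.getElem?_append_left hkx]
    · rw [List.getElem?_append_right (by omega), ← hy _ (by omega)]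
      congr 1
      omega

theorem occAt_singleton : OccAt T [a] i ↔ T[i]? = some a := by
  refine ⟨fun h => by simpa using h.getElem?_add 0 (by simp), fun h => ?_⟩
  obtain ⟨hi, -⟩ := List.getElem?_eq_some_iff.1 h
  refine ⟨by simpa using hi, fun k hk => ?_⟩
  obtain rfl : k = 0 := by simpa using hk
  simpa using h

theorem occAt_concat : OccAt T (x ++ [a]) i ↔ OccAt T x i ∧ T[i + x.length]? = some a := by
  rw [occAt_append_iff, occAt_singleton]

theorem occAt_cons : OccAt T (a :: x) i ↔ T[i]? = some a ∧ OccAt T x (i + 1) := by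
  rw [← List.singleton_append, occAt_append_iff, occAt_singleton, List.length_singleton]

theorem OccAt.restrict (hx : OccAt T x i) (hy : OccAt T y j)
    (hij : i ≤ j) (hle : j + y.length ≤ i + x.length) : OccAt x y (j - i) := by
  refine ⟨by omega, fun k hk => ?_⟩
  rw [← hy.getElem?_add k hk, ← hx.getElem?_add _ (by omega)]
  congr 1
  omega

theorem OccAt.trans (hx : OccAt T x i) (hy : OccAt x y j) : OccAt T y (i + j) := by
  have hxT := hx.add_length_le
  have hyx := hy.add_length_le
  refine ⟨by omega, fun k hk => ?_⟩
  rw [← hy.getElem?_add k hk, ← hx.getElem?_add _ (by omega), add_assoc]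

theorem suffix_iff_occAt : x <:+ T ↔ ∃ i, OccAt T x i ∧ i + x.length = T.length := by
  constructor
  · rintro ⟨l, rfl⟩
    exact ⟨l.length, by simpa using occAt_append l x [], by simp⟩
  · rintro ⟨i, h, hi⟩
    exact ⟨T.take i, by simpa [hi] using h.eq_append.symm⟩

theorem infix_of_append_infix_left (h : x ++ y <:+: T) : x <:+: T :=
  (List.prefix_append x y).isInfix.trans h

theorem infix_of_append_infix_right (h : x ++ y <:+: T) : y <:+: T :=
  (List.suffix_append x y).isInfix.trans h

end Occurrences

section Closures

variable {T x t u w : List α}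

/-- Every occurrence of `x` in `T` is preceded by `t`. -/
def AlwaysPreceded (T x t : List α) : Prop :=
  ∀ l r, T = l ++ x ++ r → t <:+ l

/-- Every occurrence of `x` in `T` is followed by `t`. -/
def AlwaysFollowed (T x t : List α) : Prop :=
  ∀ l r, T = l ++ x ++ r → t <+: r

namespace AlwaysPreceded

theorem infix_iff (h : AlwaysPreceded T x t) : t ++ x ++ w <:+: T ↔ x ++ w <:+: T := by
  constructor
  · intro hw
    rw [List.append_assoc] at hw
    exact infix_of_append_infix_right hw
  · rintro ⟨l, r, hw⟩
    obtain ⟨l, rfl⟩ := h l (w ++ r) (by simpa using hw.symm)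
    exact ⟨l, r, by simpa using hw⟩

theorem suffix_iff (h : AlwaysPreceded T x t) : t ++ x ++ w <:+ T ↔ x ++ w <:+ T := by
  constructor
  · intro hw
    rw [List.append_assoc] at hw
    exact (List.suffix_append _ _).trans hw
  · rintro ⟨l, hw⟩
    obtain ⟨l, rfl⟩ := h l w (by simpa using hw.symm)
    exact ⟨l, by simpa using hw⟩

theorem rightMaximal_iff (h : AlwaysPreceded T x t) :
    RightMaximal T (t ++ x ++ w) ↔ RightMaximal T (x ++ w) := by
  simp only [RightMaximal, List.append_assoc _ w, h.infix_iff, h.suffix_iff]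

theorem suffix_of_leftMaximal (h : AlwaysPreceded T x t) (hu : LeftMaximal T (u ++ x)) :
    t <:+ u := by
  have suffix_or : ∀ a, a :: (u ++ x) <:+: T → t <:+ u ∨ a :: u <:+ t := by
    rintro a ⟨l, r, hl⟩
    have ht : t <:+ l ++ a :: u := h _ r (by simpa using hl.symm)
    rcases List.suffix_or_suffix_of_suffix ht (List.suffix_append l (a :: u)) with ht | ht
    · exact (List.suffix_cons_iff.1 ht).elim (fun ht => Or.inr (ht ▸ List.suffix_rfl)) Or.inl
    · exact Or.inr ht
  obtain ⟨-, ⟨a, b, hab, ha, hb⟩ | ⟨r, hr⟩⟩ := hu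
  · rcases suffix_or a ha with ht | ha
    · exact ht
    rcases suffix_or b hb with ht | hb
    · exact ht
    have heq := (List.suffix_of_suffix_length_le ha hb (by simp)).eq_of_length (by simp)
    exact absurd (List.cons.inj heq).1 hab
  · exact h u r hr.symm

theorem eq_nil_of_append_suffix (h : AlwaysPreceded T x t) (hx : x <:+: T)
    (hw : x ++ w <:+ t ++ x) : w = [] := by
  obtain ⟨m, hm⟩ := hw
  have hlen : m.length + w.length = t.length := by
    have := congrArg List.length hm
    simp only [List.length_append] at this
    omega
  -- `w ≠ []` would move any occurrence of `x` further to the left.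
  have descent : ∀ (n : ℕ) (l r : List α), l.length = n → T = l ++ x ++ r → w = [] := by
    intro n
    induction n using Nat.strong_induction_on with
    | _ n ih =>
      intro l r hn hT
      obtain ⟨l, rfl⟩ := h l r hT
      by_contra hw
      have hpos := List.length_pos_iff.2 hw
      rw [List.length_append] at hn
      have hT' : T = l ++ m ++ x ++ (w ++ r) := by simpa [← hm] using hT
      exact hw (ih (l ++ m).length (by rw [List.length_append]; omega) _ _ rfl hT')
  obtain ⟨l, r, hT⟩ := hx
  exact descent _ l r rfl hT.symm

end AlwaysPreceded

theorem exists_alwaysPreceded_leftMaximal (hx : x <:+: T) :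
    ∃ t, AlwaysPreceded T x t ∧ LeftMaximal T (t ++ x) := by
  induction hn : T.length - x.length using Nat.strong_induction_on generalizing x with
  | _ n ih =>
    by_cases hL : LeftMaximal T x
    · exact ⟨[], fun _ _ _ => List.nil_suffix, hL⟩
    have exists_concat : ∀ l r, T = l ++ x ++ r → ∃ l' a, l = l' ++ [a] := by
      rintro l r rfl
      refine (List.eq_nil_or_concat' l).resolve_left ?_
      rintro rfl
      exact hL ⟨hx, Or.inr (List.prefix_append x r)⟩
    obtain ⟨l, r, hT⟩ := id hx
    obtain ⟨l, a, rfl⟩ := exists_concat l r hT.symm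
    have hax : a :: x <:+: T := ⟨l, r, by simpa using hT⟩
    have preceded : AlwaysPreceded T x [a] := by
      intro l' r' hT'
      obtain ⟨l', b, rfl⟩ := exists_concat l' r' hT'
      have hbx : b :: x <:+: T := ⟨l', r', by simpa using hT'.symm⟩
      have hba : b = a := by_contra fun hne => hL ⟨hx, Or.inl ⟨b, a, hne, hbx, hax⟩⟩
      simp [hba]
    have hlen := hax.length_le
    rw [List.length_cons] at hlen
    obtain ⟨t, ht, htL⟩ := ih _ (by rw [List.length_cons]; omega) hax rfl
    refine ⟨t ++ [a], fun l' r' hT' => ?_, by simpa using htL⟩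
    obtain ⟨l', rfl⟩ := preceded l' r' hT'
    exact (List.suffix_append_self_iff).2 (ht l' r' (by simpa using hT'))

theorem leftMaximal_reverse : LeftMaximal T.reverse x.reverse ↔ RightMaximal T x := by
  have h : ∀ a, a :: x.reverse <:+: T.reverse ↔ x ++ [a] <:+: T := fun a => by
    rw [← List.reverse_infix (l₁ := x ++ [a]), List.reverse_append, List.reverse_singleton,
      List.singleton_append]
  simp only [LeftMaximal, RightMaximal, h, List.reverse_infix, List.reverse_prefix]

theorem alwaysPreceded_reverse :
    AlwaysPreceded T.reverse x.reverse t.reverse ↔ AlwaysFollowed T x t := by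
  constructor <;> intro h l r hT
  · simpa using h r.reverse l.reverse (by simp [hT])
  · rw [← List.reverse_prefix, List.reverse_reverse]
    exact h r.reverse l.reverse (List.reverse_injective (by simp [hT]))

namespace AlwaysFollowed

theorem prefix_of_rightMaximal (h : AlwaysFollowed T x t) (hu : RightMaximal T (x ++ u)) :
    t <+: u := by
  rw [← List.reverse_suffix]
  refine (alwaysPreceded_reverse.2 h).suffix_of_leftMaximal ?_
  rwa [← List.reverse_append, leftMaximal_reverse]

theorem eq_nil_of_append_prefix (h : AlwaysFollowed T x t) (hx : x <:+: T)
    (hw : w ++ x <+: x ++ t) : w = [] := by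
  rw [← List.reverse_eq_nil_iff]
  refine (alwaysPreceded_reverse.2 h).eq_nil_of_append_suffix (List.reverse_infix.2 hx) ?_
  rwa [← List.reverse_append, ← List.reverse_append, List.reverse_suffix]

theorem leftMaximal_append_iff (h : AlwaysFollowed T x t) :
    LeftMaximal T (x ++ t) ↔ LeftMaximal T x := by
  have key := (alwaysPreceded_reverse.2 h).rightMaximal_iff (w := [])
  simpa only [List.append_nil, ← List.reverse_append, ← leftMaximal_reverse,
    List.reverse_reverse] using key

end AlwaysFollowed

theorem exists_alwaysFollowed_rightMaximal (hx : x <:+: T) :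
    ∃ t, AlwaysFollowed T x t ∧ RightMaximal T (x ++ t) := by
  obtain ⟨t, ht, htL⟩ := exists_alwaysPreceded_leftMaximal (List.reverse_infix.2 hx)
  refine ⟨t.reverse, ?_, ?_⟩
  · rwa [← alwaysPreceded_reverse, List.reverse_reverse]
  · rwa [← leftMaximal_reverse, List.reverse_append, List.reverse_reverse]

end Closures

/-! ### The CDAWG and its grammar -/

theorem finite_rightLetters (T x : List α) : {a | x ++ [a] <:+: T}.Finite :=
  (List.finite_toSet T).subset fun a ha =>
    (infix_of_append_infix_right ha).subset (List.mem_singleton_self a)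

/-- The letters that follow an occurrence of `x` in `T`. -/
noncomputable def rightLetters (T x : List α) : Finset α := (finite_rightLetters T x).toFinset

@[simp] theorem mem_rightLetters {T x : List α} {a : α} :
    a ∈ rightLetters T x ↔ x ++ [a] <:+: T := by
  simp [rightLetters]

theorem rightLetters_self (T : List α) : rightLetters T T = ∅ := by
  refine Finset.eq_empty_of_forall_notMem fun a ha => ?_
  simpa using (mem_rightLetters.1 ha).length_le

/-- The nodes of the CDAWG of `T` as a finset. -/
noncomputable def nodeFinset (T : List α) : Finset (List α) := (nodes_finite T).toFinset

@[simp] theorem mem_nodeFinset {T x : List α} : x ∈ nodeFinset T ↔ MaximalSubstring T x := by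
  simp [nodeFinset, nodes]

theorem rightMaximal_of_suffix {T x : List α} (h : x <:+ T) : RightMaximal T x :=
  ⟨h.isInfix, Or.inr h⟩

theorem self_mem_nodeFinset (T : List α) : T ∈ nodeFinset T :=
  mem_nodeFinset.2 ⟨⟨List.infix_rfl, Or.inr List.prefix_rfl⟩,
    rightMaximal_of_suffix List.suffix_rfl⟩

theorem nil_mem_nodeFinset (T : List α) : [] ∈ nodeFinset T :=
  mem_nodeFinset.2 ⟨⟨List.nil_infix, Or.inr List.nil_prefix⟩,
    rightMaximal_of_suffix List.nil_suffix⟩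

namespace EndsUniquely

variable {d : α} {T x y l r : List α}

theorem ne_nil (hT : EndsUniquely d T) : T ≠ [] := by
  obtain ⟨u, -, rfl⟩ := hT
  simp

theorem eq_nil_of_append (hT : EndsUniquely d (l ++ r)) (hd : d ∈ l) : r = [] := by
  obtain ⟨u, hu, h⟩ := hT
  rcases List.eq_nil_or_concat' r with rfl | ⟨r, a, rfl⟩
  · rfl
  · rw [← List.append_assoc] at h
    exact absurd (List.append_inj_left' h rfl ▸ List.mem_append_left r hd) hu

theorem of_append (hT : EndsUniquely d (l ++ r)) (hr : r ≠ []) : EndsUniquely d r := by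
  obtain ⟨u, hu, h⟩ := hT
  obtain ⟨r, a, rfl⟩ := (List.eq_nil_or_concat' r).resolve_left hr
  rw [← List.append_assoc] at h
  obtain ⟨rfl, ha⟩ := List.append_inj' h rfl
  exact ⟨r, fun hd => hu (List.mem_append_right l hd), by rw [ha]⟩

theorem mem (hT : EndsUniquely d T) : d ∈ T := by
  obtain ⟨u, -, rfl⟩ := hT
  simp

theorem mem_of_suffix (hT : EndsUniquely d T) (hx : x <:+ T) (hne : x ≠ []) : d ∈ x := by
  obtain ⟨l, rfl⟩ := hx
  exact (hT.of_append hne).mem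

theorem suffix_of_infix (hT : EndsUniquely d T) (hx : x <:+: T) (hd : d ∈ x) : x <:+ T := by
  obtain ⟨l, r, rfl⟩ := hx
  obtain rfl := hT.eq_nil_of_append (List.mem_append_right l hd)
  exact ⟨l, (List.append_nil _).symm⟩

theorem eq_of_leftMaximal (hT : EndsUniquely d T) (hx : LeftMaximal T x) (hd : d ∈ x) :
    x = T := by
  obtain ⟨l, rfl⟩ := hT.suffix_of_infix hx.1 hd
  have preceded : AlwaysPreceded (l ++ x) x l := by
    intro l' r h
    obtain rfl := (h ▸ hT).eq_nil_of_append (List.mem_append_right l' hd)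
    rw [List.append_nil] at h
    exact List.append_cancel_right h ▸ List.suffix_rfl
  simp [List.suffix_nil.1 (preceded.suffix_of_leftMaximal (u := []) hx)]

theorem rightLetters_nonempty (hT : EndsUniquely d T) (hx : x <:+: T) (hd : d ∉ x) :
    (rightLetters T x).Nonempty := by
  obtain ⟨r, hr, hxr⟩ : ∃ r, r ≠ [] ∧ x ++ r <:+: T := by
    obtain ⟨l, r, h⟩ := hx
    rcases eq_or_ne x [] with rfl | hne
    · exact ⟨T, hT.ne_nil, List.infix_rfl⟩
    · refine ⟨r, ?_, l, [], by simpa using h⟩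
      rintro rfl
      exact hd (hT.mem_of_suffix ⟨l, by simpa using h⟩ hne)
  obtain ⟨a, r, rfl⟩ := List.exists_cons_of_ne_nil hr
  exact ⟨a, mem_rightLetters.2 (infix_of_append_infix_left (y := r) (by simpa using hxr))⟩

theorem append_suffix_of_infix_iff (hT : EndsUniquely d T)
    (h : ∀ w, x ++ w <:+: T ↔ y ++ w <:+: T) (hx : x ++ r <:+ T) : y ++ r <:+ T := by
  rcases eq_or_ne (x ++ r) [] with hnil | hne
  · obtain ⟨rfl, rfl⟩ := List.append_eq_nil_iff.1 hnil
    have hy : y = [] := by simpa using ((h T).1 List.infix_rfl).length_le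
    simp [hy]
  · have hd := hT.mem_of_suffix hx hne
    obtain ⟨l, r', rfl⟩ := (h r).1 hx.isInfix
    obtain ⟨l', r'', hT'⟩ := (h (r ++ r')).2 ⟨l, [], by simp⟩
    have hT'' : l ++ (y ++ r) ++ r' = l' ++ (x ++ r) ++ (r' ++ r'') := by simpa using hT'.symm
    have hnil := (hT'' ▸ hT).eq_nil_of_append (List.mem_append_right l' hd)
    simp [(List.append_eq_nil_iff.1 hnil).1]

theorem eq_of_suffix_of_infix_iff (hT : EndsUniquely d T) (hx : LeftMaximal T x) (hxy : x <:+ y)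
    (h : ∀ w, x ++ w <:+: T ↔ y ++ w <:+: T) : x = y := by
  obtain ⟨t, rfl⟩ := hxy
  have preceded : AlwaysPreceded T x t := by
    rintro l r rfl
    have := hT.append_suffix_of_infix_iff h (r := r) ⟨l, by simp⟩
    simpa [List.suffix_append_self_iff] using this
  simp [List.suffix_nil.1 (preceded.suffix_of_leftMaximal (u := []) hx)]

theorem eq_of_infix_iff (hT : EndsUniquely d T) (hx : LeftMaximal T x) (hy : LeftMaximal T y)
    (h : ∀ w, x ++ w <:+: T ↔ y ++ w <:+: T) : x = y := by
  obtain ⟨l, r, hlr⟩ := hx.1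
  have hxr : x ++ r <:+ T := ⟨l, by simpa using hlr⟩
  have hyr := hT.append_suffix_of_infix_iff h hxr
  rcases List.suffix_or_suffix_of_suffix hxr hyr with hxy | hyx
  · exact hT.eq_of_suffix_of_infix_iff hx (List.suffix_append_self_iff.1 hxy) h
  · exact (hT.eq_of_suffix_of_infix_iff hy (List.suffix_append_self_iff.1 hyx)
      fun w => (h w).symm).symm

end EndsUniquely

section SuffixTree

variable {T u t β β' x y w : List α} {a : α}

theorem AlwaysFollowed.suffixTreeEdge (ht : AlwaysFollowed T (u ++ [a]) t)
    (hu : RightMaximal T u) (htR : RightMaximal T (u ++ [a] ++ t)) :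
    SuffixTreeEdge T u (a :: t) := by
  refine ⟨hu, by simp, by simpa using htR, fun γ hγ hne hγR => ?_⟩
  obtain ⟨b, γ, rfl⟩ := List.exists_cons_of_ne_nil hne
  obtain ⟨rfl, hγt⟩ := List.cons_prefix_cons.1 hγ
  have htγ := ht.prefix_of_rightMaximal (u := γ) (by simpa using hγR)
  rw [hγt.eq_of_length_le htγ.length_le]

theorem SuffixTreeEdge.eq_of_alwaysFollowed (h : SuffixTreeEdge T u (a :: β))
    (ht : AlwaysFollowed T (u ++ [a]) t) (htR : RightMaximal T (u ++ [a] ++ t)) : t = β := by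
  have htβ := ht.prefix_of_rightMaximal (u := β) (by simpa using h.2.2.1)
  have heq := h.2.2.2 (a :: t) (by simpa using htβ) (by simp) (by simpa using htR)
  exact (List.cons.inj heq).2

theorem SuffixTreeEdge.concat_infix (h : SuffixTreeEdge T u (a :: β)) : u ++ [a] <:+: T :=
  infix_of_append_infix_left (y := β) (by simpa using h.2.2.1.1)

theorem SuffixTreeEdge.label_unique (h : SuffixTreeEdge T u (a :: β))
    (h' : SuffixTreeEdge T u (a :: β')) : β = β' := by
  obtain ⟨t, ht, htR⟩ := exists_alwaysFollowed_rightMaximal h.concat_infix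
  rw [← h.eq_of_alwaysFollowed ht htR, ← h'.eq_of_alwaysFollowed ht htR]

theorem SubtreeIso.infix_of_infix (h : SubtreeIso T x y) (hx : x ++ w <:+: T) :
    y ++ w <:+: T := by
  obtain ⟨l, r, hlr⟩ := hx
  have hy := (h (w ++ r)).1 (rightMaximal_of_suffix ⟨l, by simpa using hlr⟩)
  exact infix_of_append_infix_left (y := r) (by simpa using hy.1)

theorem SubtreeIso.symm (h : SubtreeIso T x y) : SubtreeIso T y x := fun w => (h w).symm

theorem SubtreeIso.trans {z : List α} (h : SubtreeIso T x y) (h' : SubtreeIso T y z) :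
    SubtreeIso T x z := fun w => (h w).trans (h' w)

theorem EndsUniquely.eq_of_subtreeIso {d : α} (hT : EndsUniquely d T) (hx : LeftMaximal T x)
    (hy : LeftMaximal T y) (h : SubtreeIso T x y) : x = y :=
  hT.eq_of_infix_iff hx hy fun _ => ⟨h.infix_of_infix, h.symm.infix_of_infix⟩

theorem exists_mem_edges (hx : MaximalSubstring T x) (ha : x ++ [a] <:+: T) :
    ∃ β y, (x, a :: β, y) ∈ edges T := by
  obtain ⟨β, hβ, hβR⟩ := exists_alwaysFollowed_rightMaximal ha
  obtain ⟨t, ht, htL⟩ := exists_alwaysPreceded_leftMaximal hβR.1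
  have htR : RightMaximal T (t ++ (x ++ [a] ++ β)) := by
    simpa only [List.append_nil] using (ht.rightMaximal_iff (w := [])).2 (by simpa using hβR)
  refine ⟨β, t ++ (x ++ [a] ++ β), hx, ⟨htL, htR⟩, hβ.suffixTreeEdge hx.2 hβR, fun w => ?_⟩
  rw [ht.rightMaximal_iff]
  simp

end SuffixTree

section Counting

open Classical in
/-- The edges of the CDAWG of `T` that leave the node `x`. -/
noncomputable def outEdges (T x : List α) : Finset (List α × List α × List α) :=
  (edges_finite T).toFinset.filter fun e => e.1 = x

open Classical in
/-- The sum of `out-degree - 1` over the nodes of the CDAWG of `T` other than the sink, the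
out-degree of a node being its number of right letters. -/
noncomputable def excess (T : List α) : ℕ :=
  ∑ x ∈ (nodeFinset T).erase T, ((rightLetters T x).card - 1)

variable {T x y v β : List α} {d : α}

theorem mem_outEdges {e : List α × List α × List α} :
    e ∈ outEdges T x ↔ e ∈ edges T ∧ e.1 = x := by
  simp [outEdges]

theorem mem_inEdges {e : List α × List α × List α} :
    e ∈ inEdges T v ↔ e ∈ edges T ∧ e.2.2 = v := by
  simp [inEdges]

theorem size_eq_card (T : List α) : size T = (edges_finite T).toFinset.card :=
  Set.ncard_eq_toFinset_card _ _

theorem size_eq_sum_card_outEdges (T : List α) :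
    size T = ∑ x ∈ nodeFinset T, (outEdges T x).card := by
  classical
  rw [size_eq_card]
  exact Finset.card_eq_sum_card_fiberwise fun e he =>
    mem_nodeFinset.2 ((edges_finite T).mem_toFinset.1 he).1

theorem sum_card_inEdges_le_size (T : List α) (S : Finset (List α)) :
    ∑ v ∈ S, (inEdges T v).card ≤ size T := by
  classical
  have h : ∀ v, inEdges T v = (edges_finite T).toFinset.filter fun e => e.2.2 = v := fun v => by
    ext e
    simp [mem_inEdges]
  simp only [h, size_eq_card, Finset.sum_card_fiberwise_eq_card_filter]
  exact Finset.card_filter_le _ _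

theorem exists_label_eq_cons (h : (x, β, y) ∈ edges T) :
    ∃ a γ, β = a :: γ ∧ x ++ [a] <:+: T := by
  obtain ⟨a, γ, rfl⟩ := List.exists_cons_of_ne_nil h.2.2.1.2.1
  exact ⟨a, γ, rfl, h.2.2.1.concat_infix⟩

theorem injOn_head?_outEdges (hT : EndsUniquely d T) (x : List α) :
    Set.InjOn (fun e => e.2.1.head?) (outEdges T x : Set (List α × List α × List α)) := by
  rintro ⟨z, β, y⟩ hout ⟨z', β', y'⟩ hout' hhead
  obtain ⟨he, rfl : z = x⟩ := mem_outEdges.1 hout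
  obtain ⟨he', rfl : z' = z⟩ := mem_outEdges.1 hout'
  obtain ⟨a, γ, rfl, -⟩ := exists_label_eq_cons he
  obtain ⟨b, γ', rfl, -⟩ := exists_label_eq_cons he'
  obtain rfl : a = b := Option.some.inj hhead
  obtain ⟨-, hy, hedge, hiso⟩ := he
  obtain ⟨-, hy', hedge', hiso'⟩ := he'
  obtain rfl := hedge.label_unique hedge'
  obtain rfl : y = y' := hT.eq_of_subtreeIso hy.1 hy'.1 (hiso.symm.trans hiso')
  rfl

open Classical in
theorem image_head?_outEdges (hx : MaximalSubstring T x) :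
    (outEdges T x).image (fun e => e.2.1.head?) = (rightLetters T x).image some := by
  ext o
  simp only [Finset.mem_image, mem_outEdges, mem_rightLetters]
  constructor
  · rintro ⟨⟨z, β, y⟩, ⟨he, rfl⟩, rfl⟩
    obtain ⟨a, γ, rfl, ha⟩ := exists_label_eq_cons he
    exact ⟨a, ha, rfl⟩
  · rintro ⟨a, ha, rfl⟩
    obtain ⟨β, y, he⟩ := exists_mem_edges hx ha
    exact ⟨_, ⟨he, rfl⟩, rfl⟩

theorem card_outEdges (hT : EndsUniquely d T) (hx : MaximalSubstring T x) :
    (outEdges T x).card = (rightLetters T x).card := by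
  classical
  rw [← Finset.card_image_of_injOn (injOn_head?_outEdges hT x), image_head?_outEdges hx,
    Finset.card_image_of_injective _ (Option.some_injective α)]

theorem size_eq_sum_card_rightLetters (hT : EndsUniquely d T) :
    size T = ∑ x ∈ nodeFinset T, (rightLetters T x).card := by
  rw [size_eq_sum_card_outEdges]
  exact Finset.sum_congr rfl fun x hx => card_outEdges hT (mem_nodeFinset.1 hx)

open Classical in
theorem notMem_of_mem_nodeFinset_erase (hT : EndsUniquely d T)
    (hx : x ∈ (nodeFinset T).erase T) : d ∉ x := by
  rw [Finset.mem_erase, mem_nodeFinset] at hx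
  exact fun hd => hx.1 (hT.eq_of_leftMaximal hx.2.1 hd)

theorem excess_add_card_nodeFinset (hT : EndsUniquely d T) :
    excess T + (nodeFinset T).card = size T + 1 := by
  classical
  have hsink := self_mem_nodeFinset T
  rw [size_eq_sum_card_rightLetters hT, excess, ← Finset.card_erase_add_one hsink,
    ← Finset.add_sum_erase _ _ hsink, rightLetters_self, Finset.card_empty, zero_add, ← add_assoc,
    Finset.card_eq_sum_ones, ← Finset.sum_add_distrib]
  congr 1
  refine Finset.sum_congr rfl fun x hx => Nat.sub_add_cancel ?_
  exact (hT.rightLetters_nonempty (mem_nodeFinset.1 (Finset.mem_of_mem_erase hx)).1.1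
    (notMem_of_mem_nodeFinset_erase hT hx)).card_pos

theorem LeftMaximal.of_append (h : LeftMaximal T (x ++ y)) : LeftMaximal T x := by
  obtain ⟨hxy, ⟨a, b, hab, ha, hb⟩ | hpre⟩ := h
  · exact ⟨infix_of_append_infix_left hxy, Or.inl ⟨a, b, hab,
      infix_of_append_infix_left (x := a :: x) ha, infix_of_append_infix_left (x := b :: x) hb⟩⟩
  · exact ⟨infix_of_append_infix_left hxy, Or.inr ((List.prefix_append x y).trans hpre)⟩

theorem inEdges_nonempty (hv : MaximalSubstring T v) (hne : v ≠ []) :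
    (inEdges T v).Nonempty := by
  have hfin : {x | RightMaximal T x ∧ x <+: v ∧ x ≠ v}.Finite :=
    (finite_infix T).subset fun x hx => hx.1.1
  obtain ⟨x, ⟨hR, ⟨β, rfl⟩, hxv⟩, hmax⟩ := Set.exists_max_image _ List.length hfin
    ⟨[], rightMaximal_of_suffix List.nil_suffix, List.nil_prefix, hne.symm⟩
  refine ⟨(x, β, x ++ β), mem_inEdges.2 ⟨⟨⟨hv.1.of_append, hR⟩, hv,
    ⟨hR, by simpa using hxv, hv.2, fun γ hγ hγ0 hγR => ?_⟩, fun _ => Iff.rfl⟩, rfl⟩⟩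
  by_contra hne'
  have hlen := hmax (x ++ γ) ⟨hγR, by simpa using hγ, by simpa using hne'⟩
  rw [List.length_append] at hlen
  have := List.length_pos_iff.2 hγ0
  omega

theorem length_rhs (T v : List α) : (rhs T v).length = (inEdges T v).card := by
  simp [rhs]

open Classical in
theorem gsize_eq_sum_card_inEdges (T : List α) :
    gsize T = ∑ v ∈ ((nodeFinset T).erase []).filter fun v => (inEdges T v).card ≠ 1,
      (inEdges T v).card := by
  have hinitial : initialGrammar T = ((nodeFinset T).erase []).image fun v => ⟨v, rhs T v⟩ := by
    simp only [initialGrammar, nodeFinset]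
  rw [gsize, grammarSize, grammar, Finset.sum_image, hinitial, Finset.filter_image,
    Finset.sum_image]
  · simp only [length_rhs, List.length_map]
  · exact fun v _ w _ h => (ContextFreeRule.mk.inj h).1
  · intro r hr r' hr' h
    simp only [hinitial, Finset.coe_filter, Finset.mem_image, Set.mem_ofPred_eq] at hr hr'
    obtain ⟨⟨v, -, rfl⟩, -⟩ := hr
    obtain ⟨⟨w, -, rfl⟩, -⟩ := hr'
    obtain rfl : v = w := (ContextFreeRule.mk.inj h).1
    rfl

theorem gsize_le_two_mul_excess (hT : EndsUniquely d T) : gsize T ≤ 2 * excess T := by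
  classical
  have hrules : gsize T + 2 * ((nodeFinset T).erase []).card ≤
      2 * ∑ v ∈ (nodeFinset T).erase [], (inEdges T v).card := by
    rw [gsize_eq_sum_card_inEdges, Finset.sum_filter, Finset.card_eq_sum_ones, Finset.mul_sum,
      Finset.mul_sum, ← Finset.sum_add_distrib]
    refine Finset.sum_le_sum fun v hv => ?_
    rw [Finset.mem_erase, mem_nodeFinset] at hv
    have hpos := (inEdges_nonempty hv.2 hv.1).card_pos
    split_ifs <;> omega
  have hin := sum_card_inEdges_le_size T ((nodeFinset T).erase [])
  have hexcess := excess_add_card_nodeFinset hT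
  have hsource := Finset.card_erase_add_one (nil_mem_nodeFinset T)
  omega

end Counting

/-! ### Prefixes and suffixes extended to nodes -/

section BranchingPrefixes

variable {T s p x t : List α} {a b : α} {k l : ℕ}

theorem AlwaysPreceded.rightLetters_append (h : AlwaysPreceded T x t) :
    rightLetters T (t ++ x) = rightLetters T x := by
  ext a
  rw [mem_rightLetters, mem_rightLetters, h.infix_iff]

theorem two_le_card_rightLetters (hab : a ≠ b) (ha : x ++ [a] <:+: T) (hb : x ++ [b] <:+: T) :
    2 ≤ (rightLetters T x).card :=
  Finset.one_lt_card.2 ⟨a, mem_rightLetters.2 ha, b, mem_rightLetters.2 hb, hab⟩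

theorem rightMaximal_of_two_le_card (h : 2 ≤ (rightLetters T x).card) : RightMaximal T x := by
  obtain ⟨a, ha, b, hb, hab⟩ := Finset.one_lt_card.1 h
  rw [mem_rightLetters] at ha hb
  exact ⟨infix_of_append_infix_left ha, Or.inl ⟨a, b, hab, ha, hb⟩⟩

open Classical in
/-- The lengths of the proper prefixes of `s` that have at least two right letters in `T`. -/
noncomputable def branchingPrefixes (T s : List α) : Finset ℕ :=
  (Finset.range s.length).filter fun k => 2 ≤ (rightLetters T (s.take k)).card

theorem mem_branchingPrefixes :
    k ∈ branchingPrefixes T s ↔ k < s.length ∧ 2 ≤ (rightLetters T (s.take k)).card := by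
  simp [branchingPrefixes]

theorem eq_of_alwaysPreceded_take {t : ℕ → List α} (hs : s <:+: T)
    (ht : ∀ k, AlwaysPreceded T (s.take k) (t k)) (hk : k ≤ s.length) (hl : l ≤ s.length)
    (h : t k ++ s.take k = t l ++ s.take l) : k = l := by
  wlog hkl : k ≤ l generalizing k l
  · exact (this hl hk h.symm (le_of_not_ge hkl)).symm
  obtain ⟨w, hw⟩ := List.take_prefix_take_left (l := s) hkl
  have hnil : w = [] := (ht k).eq_nil_of_append_suffix
    ((List.take_prefix k s).isInfix.trans hs) (by rw [hw, h]; exact List.suffix_append _ _)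
  simpa [hnil, hk, hl] using congrArg List.length hw

open Classical in
theorem exists_injOn_branchingPrefixes (hs : s <:+: T) :
    ∃ g : ℕ → List α, Set.InjOn g (branchingPrefixes T s) ∧ ∀ k ∈ branchingPrefixes T s,
      g k ∈ (nodeFinset T).erase T ∧ rightLetters T (g k) = rightLetters T (s.take k) := by
  choose t ht htL using fun k =>
    exists_alwaysPreceded_leftMaximal ((List.take_prefix k s).isInfix.trans hs)
  refine ⟨fun k => t k ++ s.take k, fun k hk l hl h => ?_,
    fun k hk => ⟨?_, (ht k).rightLetters_append⟩⟩
  · exact eq_of_alwaysPreceded_take hs ht (mem_branchingPrefixes.1 hk).1.le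
      (mem_branchingPrefixes.1 hl).1.le h
  · have htwo : 2 ≤ (rightLetters T (t k ++ s.take k)).card := by
      rw [(ht k).rightLetters_append]
      exact (mem_branchingPrefixes.1 hk).2
    refine Finset.mem_erase.2
      ⟨fun h => ?_, mem_nodeFinset.2 ⟨htL k, rightMaximal_of_two_le_card htwo⟩⟩
    simp [h, rightLetters_self] at htwo

theorem card_branchingPrefixes_lt (hs : s <:+: T) :
    (branchingPrefixes T s).card < (nodeFinset T).card := by
  classical
  obtain ⟨g, hg, hmem⟩ := exists_injOn_branchingPrefixes hs
  rw [← Finset.card_erase_add_one (self_mem_nodeFinset T), Nat.lt_succ_iff]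
  exact Finset.card_le_card_of_injOn g (fun k hk => (hmem k hk).1) hg

theorem sum_card_rightLetters_take_le_excess (hs : s <:+: T) :
    ∑ k ∈ Finset.range s.length, ((rightLetters T (s.take k)).card - 1) ≤ excess T := by
  classical
  obtain ⟨g, hg, hmem⟩ := exists_injOn_branchingPrefixes hs
  calc ∑ k ∈ Finset.range s.length, ((rightLetters T (s.take k)).card - 1)
      = ∑ k ∈ branchingPrefixes T s, ((rightLetters T (g k)).card - 1) := by
        rw [branchingPrefixes, Finset.sum_filter]
        refine Finset.sum_congr rfl fun k hk => ?_
        split_ifs with h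
        · rw [(hmem k (Finset.mem_filter.2 ⟨hk, h⟩)).2]
        · omega
    _ = ∑ x ∈ (branchingPrefixes T s).image g, ((rightLetters T x).card - 1) := by
        rw [Finset.sum_image hg]
    _ ≤ excess T := Finset.sum_le_sum_of_subset (Finset.image_subset_iff.2 fun k hk =>
        (hmem k hk).1)

theorem eq_of_alwaysFollowed_drop {t : ℕ → List α} (hp : p <:+: T)
    (ht : ∀ k, AlwaysFollowed T (p.drop k) (t k)) (hk : k ≤ p.length) (hl : l ≤ p.length)
    (h : p.drop k ++ t k = p.drop l ++ t l) : k = l := by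
  wlog hkl : l ≤ k generalizing k l
  · exact (this hl hk h.symm (le_of_not_ge hkl)).symm
  obtain ⟨w, hw⟩ := List.drop_suffix_drop_left p hkl
  have hnil : w = [] := (ht k).eq_nil_of_append_prefix
    ((List.drop_suffix k p).isInfix.trans hp) (by rw [hw, h]; exact List.prefix_append _ _)
  have hlen := congrArg List.length hw
  simp only [hnil, List.nil_append, List.length_drop] at hlen
  omega

open Classical in
theorem card_leftMaximal_drop_le (hp : p <:+: T) :
    ((Finset.range (p.length + 1)).filter fun i => LeftMaximal T (p.drop i)).card ≤
      (nodeFinset T).card := by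
  choose t ht htR using fun i =>
    exists_alwaysFollowed_rightMaximal ((List.drop_suffix i p).isInfix.trans hp)
  refine Finset.card_le_card_of_injOn (fun i => p.drop i ++ t i) (fun i hi => ?_) ?_
  · exact mem_nodeFinset.2 ⟨(ht i).leftMaximal_append_iff.2 (Finset.mem_filter.1 hi).2, htR i⟩
  · intro i hi j hj h
    simp only [Finset.coe_filter, Finset.mem_range, Nat.lt_succ_iff, Set.mem_ofPred_eq] at hi hj
    exact eq_of_alwaysFollowed_drop hp ht hi.1 hj.1 h

end BranchingPrefixes

section Borders

variable {T p s : List α} {d : α} {k l t : ℕ}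

open Classical in
/-- The lengths of the proper prefixes of `s` that are suffixes of `p`. -/
noncomputable def borders (p s : List α) : Finset ℕ :=
  (Finset.range s.length).filter fun k => s.take k <:+ p

theorem mem_borders : k ∈ borders p s ↔ k < s.length ∧ s.take k <:+ p := by
  simp [borders]

theorem card_le_of_first_mismatch {β : Type*} (f : ℕ → β) (K B : Finset ℕ)
    (hf : ∀ k ∈ K, ∀ l ∈ K, k < l → ∃ t, f (k + t) ≠ f (l + t))
    (hB : ∀ k ∈ K, ∀ l ∈ K, k < l → ∀ t, f (k + t) ≠ f (l + t) →
      (∀ u < t, f (k + u) = f (l + u)) → k + t ∈ B) :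
    K.card ≤ B.card + 1 := by
  classical
  rcases K.eq_empty_or_nonempty with rfl | hne
  · simp
  have hmax := K.max'_mem hne
  have hfirst : ∀ k ∈ K.erase (K.max' hne), ∃ t, (∃ l ∈ K, k < l ∧ f (k + t) ≠ f (l + t)) ∧
      ∀ u < t, ∀ l ∈ K, k < l → f (k + u) = f (l + u) := by
    intro k hk
    obtain ⟨hkmax, hkK⟩ := Finset.mem_erase.1 hk
    have hlt := lt_of_le_of_ne (K.le_max' k hkK) hkmax
    have hex : ∃ t, ∃ l ∈ K, k < l ∧ f (k + t) ≠ f (l + t) :=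
      (hf k hkK _ hmax hlt).imp fun t ht => ⟨_, hmax, hlt, ht⟩
    refine ⟨Nat.find hex, Nat.find_spec hex, fun u hu l hl hkl => ?_⟩
    exact by_contra fun h => Nat.find_min hex hu ⟨l, hl, hkl, h⟩
  choose! L hL hagree using hfirst
  -- The first mismatches are nondecreasing, as a mismatch between `l` and some `j > l` forces one
  -- between `k` and `l` or between `k` and `j`.
  have hmono : StrictMonoOn (fun k => k + L k) (K.erase (K.max' hne)) := by
    intro k hk l hl hkl
    obtain ⟨j, hj, hlj, hne⟩ := hL l hl
    refine add_lt_add_of_lt_of_le hkl (le_of_not_gt fun hlt => hne ?_)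
    exact (hagree k hk _ hlt l (Finset.mem_of_mem_erase hl) hkl).symm.trans
      (hagree k hk _ hlt j hj (hkl.trans hlj))
  rw [← Finset.card_erase_add_one hmax]
  refine Nat.succ_le_succ (Finset.card_le_card_of_injOn _ (fun k hk => ?_) hmono.injOn)
  obtain ⟨l, hl, hkl, hne⟩ := hL k hk
  exact hB k (Finset.mem_of_mem_erase hk) l hl hkl _ hne fun u hu => hagree k hk u hu l hl hkl

theorem EndsUniquely.exists_mismatch (hs : EndsUniquely d s) (hkl : k < l) (hl : l < s.length) :
    ∃ t, l + t < s.length ∧ s[k + t]? ≠ s[l + t]? := by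
  obtain ⟨u, hu, rfl⟩ := hs
  rw [List.length_append, List.length_singleton] at hl ⊢
  refine ⟨u.length - l, by omega, fun h => hu ?_⟩
  rw [Nat.add_sub_cancel' (by omega), List.getElem?_concat_length,
    List.getElem?_append_left (by omega)] at h
  exact List.mem_of_getElem? h

theorem add_mem_branchingPrefixes (hs : s <:+: T) (hkl : k < l) (ht : l + t < s.length)
    (hsuf : s.take k <:+ s.take l) (hne : s[k + t]? ≠ s[l + t]?)
    (heq : ∀ u < t, s[k + u]? = s[l + u]?) : k + t ∈ branchingPrefixes T s := by
  have hlen : (s.take (k + t)).length = k + t := List.length_take_of_le (by omega)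
  have hleft : OccAt s (s.take (k + t)) 0 := prefix_iff_occAt.1 (List.take_prefix _ _)
  have hright : OccAt s (s.take (k + t)) (l - k) := by
    obtain ⟨i, hi, hil⟩ := suffix_iff_occAt.1 hsuf
    rw [List.length_take_of_le (by omega), List.length_take_of_le (by omega)] at hil
    obtain rfl : i = l - k := by omega
    refine ⟨by omega, fun u hu => ?_⟩
    rw [List.getElem?_take_of_lt (by omega)]
    by_cases huk : u < k
    · have := hi.getElem?_add u (by rw [List.length_take_of_le (by omega)]; exact huk)
      rwa [List.getElem?_take_of_lt huk, List.getElem?_take_of_lt (by omega)] at this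
    · have := heq (u - k) (by omega)
      rw [show k + (u - k) = u by omega] at this
      rw [this]
      congr 1
      omega
  have infix_concat : ∀ {i} (hi : i + (k + t) < s.length), OccAt s (s.take (k + t)) i →
      s.take (k + t) ++ [s[i + (k + t)]] <:+: T := fun hi h =>
    (occAt_concat.2 ⟨h, by rw [hlen, List.getElem?_eq_getElem hi]⟩).infix.trans hs
  refine mem_branchingPrefixes.2 ⟨by omega, two_le_card_rightLetters (fun h => hne ?_)
    (infix_concat (by omega) hleft) (infix_concat (by omega) hright)⟩
  rw [List.getElem?_eq_getElem (by omega), List.getElem?_eq_getElem ht, Option.some.injEq]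
  convert h using 2 <;> omega

theorem card_borders_le (hs : EndsUniquely d s) (hsT : s <:+: T) (p : List α) :
    (borders p s).card ≤ (branchingPrefixes T s).card + 1 := by
  refine card_le_of_first_mismatch (fun i => s[i]?) _ _ (fun k _ l hl hkl => ?_)
    fun k hk l hl hkl t hne heq => ?_
  · obtain ⟨t, -, ht⟩ := hs.exists_mismatch hkl (mem_borders.1 hl).1
    exact ⟨t, ht⟩
  · obtain ⟨hkn, hk⟩ := mem_borders.1 hk
    obtain ⟨hln, hl⟩ := mem_borders.1 hl
    have hlt : l + t < s.length := by
      obtain ⟨u, hu, hne⟩ := hs.exists_mismatch hkl hln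
      have : t ≤ u := le_of_not_gt fun hut => hne (heq u hut)
      omega
    have hsuf : s.take k <:+ s.take l :=
      List.suffix_of_suffix_length_le hk hl (by simp only [List.length_take]; omega)
    exact add_mem_branchingPrefixes hsT hkl hlt hsuf hne heq

end Borders

/-! ### Left contexts and new right letters -/

section LeftContexts

variable {T T' x y : List α} {o : Option α} {i j : ℕ}

/-- The left context of position `i` in `T`: the letter before it, or `none` if `i = 0`. -/
def leftContext (T : List α) (i : ℕ) : Option α := if i = 0 then none else T[i - 1]?

/-- `x` occurs in `T` with left context `o`. -/
def HasLeftContext (T x : List α) : Option α → Prop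
  | none => x <+: T
  | some a => a :: x <:+: T

/-- `x` occurs in `T'` at position `i` with a left context that it does not have in `T`. -/
structure LeftNew (T T' x : List α) (i : ℕ) : Prop where
  occAt : OccAt T' x i
  not_hasLeftContext : ¬ HasLeftContext T x (leftContext T' i)

theorem leftContext_eq_some (hi : i ≠ 0) (hiT : i ≤ T.length) :
    ∃ a, leftContext T i = some a ∧ T[i - 1]? = some a := by
  have hlt : i - 1 < T.length := by omega
  exact ⟨T[i - 1], by simp [leftContext, hi, hlt], List.getElem?_eq_getElem hlt⟩

theorem HasLeftContext.exists_occAt (h : HasLeftContext T x o) :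
    ∃ i, OccAt T x i ∧ leftContext T i = o := by
  cases o with
  | none => exact ⟨0, prefix_iff_occAt.1 h, rfl⟩
  | some a =>
    obtain ⟨i, hi⟩ := infix_iff_exists_occAt.1 h
    rw [occAt_cons] at hi
    exact ⟨i + 1, hi.2, by simpa [leftContext] using hi.1⟩

theorem exists_leftContext_ne (hL : LeftMaximal T x) (hi : OccAt T x i) (hi0 : i ≠ 0) :
    ∃ j k, OccAt T x j ∧ OccAt T x k ∧ leftContext T j ≠ leftContext T k := by
  obtain ⟨-, ⟨a, b, hab, ha, hb⟩ | hprefix⟩ := hL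
  · obtain ⟨j, hj, hja⟩ := HasLeftContext.exists_occAt (o := some a) ha
    obtain ⟨k, hk, hkb⟩ := HasLeftContext.exists_occAt (o := some b) hb
    exact ⟨j, k, hj, hk, by simpa [hja, hkb] using hab⟩
  · obtain ⟨a, ha, -⟩ := leftContext_eq_some hi0 (le_of_add_le_left hi.add_length_le)
    exact ⟨0, i, prefix_iff_occAt.1 hprefix, hi, by rw [ha]; simp [leftContext]⟩

theorem exists_leftNew (hx : x <:+: T) (hL : ¬ LeftMaximal T x) (hL' : LeftMaximal T' x) :
    ∃ i, LeftNew T T' x i := by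
  suffices h : ∃ o, HasLeftContext T' x o ∧ ¬ HasLeftContext T x o by
    obtain ⟨o, ho', ho⟩ := h
    obtain ⟨i, hi, rfl⟩ := ho'.exists_occAt
    exact ⟨i, hi, ho⟩
  obtain ⟨-, ⟨a, b, hab, ha, hb⟩ | hprefix⟩ := hL'
  · by_cases haT : a :: x <:+: T
    · exact ⟨some b, hb, fun hbT => hL ⟨hx, Or.inl ⟨a, b, hab, haT, hbT⟩⟩⟩
    · exact ⟨some a, ha, haT⟩
  · exact ⟨none, hprefix, fun h => hL ⟨hx, Or.inr h⟩⟩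

theorem LeftNew.exists_cons (h : LeftNew T T' x i) (hi : i ≠ 0) :
    ∃ a, OccAt T' (a :: x) (i - 1) ∧ ¬ a :: x <:+: T := by
  obtain ⟨a, hia, ha⟩ := leftContext_eq_some hi (le_of_add_le_left h.occAt.add_length_le)
  refine ⟨a, occAt_cons.2 ⟨ha, ?_⟩, fun hax => h.not_hasLeftContext (by rwa [hia])⟩
  rw [Nat.sub_add_cancel (Nat.one_le_iff_ne_zero.2 hi)]
  exact h.occAt

theorem LeftNew.length_le (hi : LeftNew T T' x i) (hj : OccAt T' y j) (hy : y <:+: T)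
    (hij : i + x.length = j + y.length) : y.length ≤ x.length := by
  by_contra hlt
  obtain ⟨a, ha, hnew⟩ := hi.exists_cons (by omega)
  exact hnew ((hj.restrict ha (by omega) (by rw [List.length_cons]; omega)).infix.trans hy)

end LeftContexts

section EditPosition

variable {p b c s x : List α} {a : α} {i : ℕ}

theorem infix_append_append_left (p b s : List α) : p <:+: p ++ b ++ s := by
  rw [List.append_assoc]
  exact (List.prefix_append _ _).isInfix

theorem infix_append_append_right (p b s : List α) : s <:+: p ++ b ++ s :=
  (List.suffix_append _ _).isInfix

theorem occAt_append_append_left (p c s : List α) : OccAt (p ++ c ++ s) p 0 := by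
  simpa using occAt_append [] p (c ++ s)

theorem occAt_append_append_right (p c s : List α) :
    OccAt (p ++ c ++ s) s (p.length + c.length) := by
  simpa using occAt_append (p ++ c) s []

theorem occAt_drop (p c s : List α) (hi : i ≤ p.length) :
    OccAt (p ++ c ++ s) (p.drop i) i := by
  have h : OccAt p (p.drop i) i := by simpa [hi] using occAt_append (p.take i) (p.drop i) []
  simpa using (occAt_append_append_left p c s).trans h

theorem OccAt.of_add_length_le (h : OccAt (p ++ c ++ s) x i) (hi : i + x.length ≤ p.length) :
    OccAt p x i := by
  simpa using (occAt_append_append_left p c s).restrict h (Nat.zero_le i) (by omega)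

theorem OccAt.crosses (h : OccAt (p ++ c ++ s) x i) (hx : ¬ x <:+: p ++ b ++ s) :
    i < p.length + c.length ∧ p.length < i + x.length := by
  constructor <;> by_contra hi
  · have hle := h.add_length_le
    simp only [List.length_append] at hle
    have hs := (occAt_append_append_right p c s).restrict h (by omega) (by omega)
    exact hx (hs.infix.trans (infix_append_append_right p b s))
  · exact hx ((h.of_add_length_le (by omega)).infix.trans (infix_append_append_left p b s))

theorem OccAt.crosses_of_concat (hc : c.length ≤ 1) (h : OccAt (p ++ c ++ s) (x ++ [a]) i)
    (ha : ¬ x ++ [a] <:+: p ++ b ++ s) : i ≤ p.length ∧ p.length ≤ i + x.length := by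
  have := h.crosses ha
  simp only [List.length_append, List.length_singleton] at this
  omega

theorem LeftNew.crosses (hc : c.length ≤ 1) (h : LeftNew (p ++ b ++ s) (p ++ c ++ s) x i) :
    i ≤ p.length + c.length ∧ p.length + c.length ≤ i + x.length := by
  rcases eq_or_ne i 0 with rfl | hi
  · refine ⟨by omega, by_contra fun hlt => h.not_hasLeftContext ?_⟩
    have hpre : x <+: p := prefix_iff_occAt.2 (h.occAt.of_add_length_le (by omega))
    exact hpre.trans (by rw [List.append_assoc]; exact List.prefix_append _ _)
  · obtain ⟨a, ha, hnew⟩ := h.exists_cons hi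
    have := ha.crosses hnew
    rw [List.length_cons] at this
    omega

end EditPosition

section NewLetters

variable {T T' x y p b c s : List α} {a e : α} {i : ℕ}

open Classical in
/-- The right letters of `x` in `T'` that are not right letters of `x` in `T`. -/
noncomputable def newLetters (T T' x : List α) : Finset α := rightLetters T' x \ rightLetters T x

theorem mem_newLetters :
    a ∈ newLetters T T' x ↔ x ++ [a] <:+: T' ∧ ¬ x ++ [a] <:+: T := by
  simp [newLetters]

theorem card_rightLetters_le_add_card_newLetters (T T' x : List α) :
    (rightLetters T' x).card ≤ (rightLetters T x).card + (newLetters T T' x).card := by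
  classical
  rw [add_comm, newLetters]
  exact Finset.card_le_card_sdiff_add_card

theorem OccAt.length_le_of_concat (hy : OccAt T' y i) (hyT : y <:+: T)
    (hx : OccAt T' (x ++ [a]) i) (hxT : ¬ x ++ [a] <:+: T) : y.length ≤ x.length := by
  by_contra hlt
  exact hxT ((hy.restrict hx le_rfl (by simp; omega)).infix.trans hyT)

theorem OccAt.concat_inj (hx : OccAt T' (x ++ [a]) i) (hxT : x <:+: T)
    (ha : ¬ x ++ [a] <:+: T) (hy : OccAt T' (y ++ [e]) i) (hyT : y <:+: T)
    (he : ¬ y ++ [e] <:+: T) : x = y ∧ a = e := by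
  have hxy := (occAt_concat.1 hx).1.length_le_of_concat hxT hy he
  have hyx := (occAt_concat.1 hy).1.length_le_of_concat hyT hx ha
  simpa using
    List.append_inj (hx.eq_of_length_eq hy (by simp; omega)) (by omega)

theorem OccAt.drop_prefix (h : OccAt (p ++ c ++ s) x i) (hi : i ≤ p.length)
    (hle : p.length ≤ i + x.length) : p.drop i <+: x :=
  prefix_iff_occAt.2 (by
    simpa using h.restrict (occAt_drop p c s hi) le_rfl (by rw [List.length_drop]; omega))

theorem sum_card_newLetters_le_card_nodeFinset (hc : c.length ≤ 1) (S : Finset (List α))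
    (hS : ∀ x ∈ S, LeftMaximal (p ++ b ++ s) x) :
    ∑ x ∈ S, (newLetters (p ++ b ++ s) (p ++ c ++ s) x).card ≤
      (nodeFinset (p ++ b ++ s)).card := by
  classical
  have hocc : ∀ z ∈ S.sigma (newLetters (p ++ b ++ s) (p ++ c ++ s)),
      ∃ i, OccAt (p ++ c ++ s) (z.1 ++ [z.2]) i := fun z hz =>
    infix_iff_exists_occAt.1 (mem_newLetters.1 (Finset.mem_sigma.1 hz).2).1
  choose! f hf using hocc
  rw [← Finset.card_sigma]
  refine (Finset.card_le_card_of_injOn f (fun z hz => ?_) fun z hz w hw h => ?_).trans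
    (card_leftMaximal_drop_le (infix_append_append_left p b s))
  · have hfz := hf z hz
    obtain ⟨hzS, hz⟩ := Finset.mem_sigma.1 hz
    obtain ⟨hi, hle⟩ := hfz.crosses_of_concat hc (mem_newLetters.1 hz).2
    obtain ⟨t, ht⟩ := (occAt_concat.1 hfz).1.drop_prefix hi hle
    have hL := hS z.1 hzS
    rw [← ht] at hL
    exact Finset.mem_filter.2 ⟨Finset.mem_range.2 (Nat.lt_succ_of_le hi), hL.of_append⟩
  · have hfw := hf w hw
    rw [← h] at hfw
    obtain ⟨hzS, hz'⟩ := Finset.mem_sigma.1 hz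
    obtain ⟨hwS, hw'⟩ := Finset.mem_sigma.1 hw
    obtain ⟨h₁, h₂⟩ := (hf z hz).concat_inj (hS _ hzS).1 (mem_newLetters.1 hz').2 hfw
      (hS _ hwS).1 (mem_newLetters.1 hw').2
    exact Sigma.ext h₁ (heq_of_eq h₂)

end NewLetters

/-! ### Pairs of occurrences around the edit -/

section BranchingPairs

variable {T x y : List α} {P C D i j k : ℕ}

theorem OccAt.getElem?_eq_of_three (hi : OccAt T x i) (hj : OccAt T x j) (hk : OccAt T x k)
    (hij : i < j) (hjk : j < k) (hle : k ≤ i + x.length) :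
    T[i + x.length]? = T[j + x.length]? :=
  calc T[i + x.length]?
      = T[k + (x.length - (k - i))]? := by congr 1; omega
    _ = T[j + (x.length - (k - i))]? :=
        (hk.getElem?_add _ (by omega)).trans (hj.getElem?_add _ (by omega)).symm
    _ = T[i + (x.length - (k - j))]? := by congr 1; omega
    _ = T[k + (x.length - (k - j))]? :=
        (hi.getElem?_add _ (by omega)).trans (hk.getElem?_add _ (by omega)).symm
    _ = T[j + x.length]? := by congr 1; omega

theorem card_rightLetters_le_two
    (h : ∀ i j, OccAt T x i → OccAt T x j → j ≤ i + x.length) : (rightLetters T x).card ≤ 2 := by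
  by_contra hlt
  obtain ⟨a, ha, b, hb, e, he, hab, hae, hbe⟩ := Finset.two_lt_card.1 (not_le.1 hlt)
  simp only [mem_rightLetters, infix_iff_exists_occAt, occAt_concat] at ha hb he
  obtain ⟨i, hi, hia⟩ := ha
  obtain ⟨j, hj, hjb⟩ := hb
  obtain ⟨k, hk, hke⟩ := he
  have hthree : ∀ i j k, OccAt T x i → OccAt T x j → OccAt T x k → i < j → j < k →
      T[i + x.length]? = T[j + x.length]? := fun i j k hi hj hk hij hjk =>
    hi.getElem?_eq_of_three hj hk hij hjk (h i k hi hk)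
  grind

/-- Two occurrences of `x` in `T`, at positions `i` and `i + D`, that differ both in their left
contexts and in their right letters and reach into the window from `P` to `C`. -/
structure BranchingPair (T : List α) (P C : ℕ) (x : List α) (i D : ℕ) : Prop where
  occ_left : OccAt T x i
  occ_right : OccAt T x (i + D)
  le_left : P ≤ i + x.length
  right_le : i + D ≤ C
  left_ne : leftContext T i ≠ leftContext T (i + D)
  right_ne : T[i + x.length]? ≠ T[i + D + x.length]?

namespace BranchingPair

theorem pos (h : BranchingPair T P C x i D) : 0 < D :=
  Nat.pos_of_ne_zero fun hD => h.left_ne (by rw [hD, add_zero])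

theorem start_le (hC : C ≤ P + 1) (hx : BranchingPair T P C x i D)
    (hy : BranchingPair T P C y j D) : j ≤ i := by
  by_contra hlt
  have hD := hx.pos
  have hPi := hx.le_left
  have hjC := hy.right_le
  refine hy.left_ne ?_
  have hagree := (hx.occ_left.getElem?_add (j - 1 - i) (by omega)).trans
    (hx.occ_right.getElem?_add (j - 1 - i) (by omega)).symm
  rw [leftContext, leftContext, if_neg (by omega), if_neg (by omega)]
  convert hagree using 2 <;> omega

theorem length_le (hx : BranchingPair T P C x i D) (hy : BranchingPair T P C y i D) :
    y.length ≤ x.length := by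
  by_contra hlt
  exact hx.right_ne ((hy.occ_left.getElem?_add _ (not_le.1 hlt)).trans
    (hy.occ_right.getElem?_add _ (not_le.1 hlt)).symm)

theorem start_eq (hC : C ≤ P + 1) (hx : BranchingPair T P C x i D)
    (hy : BranchingPair T P C y j D) : i = j :=
  le_antisymm (hy.start_le hC hx) (hx.start_le hC hy)

theorem eq_of_dist_eq (hC : C ≤ P + 1) (hx : BranchingPair T P C x i D)
    (hy : BranchingPair T P C y j D) : x = y := by
  obtain rfl := hx.start_eq hC hy
  exact hx.occ_left.eq_of_length_eq hy.occ_left (le_antisymm (hy.length_le hx) (hx.length_le hy))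

theorem of_occAt (hi : OccAt T x i) (hj : OccAt T x j) (hPi : P ≤ i + x.length)
    (hPj : P ≤ j + x.length) (hiC : i ≤ C) (hjC : j ≤ C)
    (hleft : leftContext T i ≠ leftContext T j)
    (hright : T[i + x.length]? ≠ T[j + x.length]?) :
    BranchingPair T P C x (min i j) (max i j - min i j) := by
  wlog hij : i ≤ j generalizing i j
  · rw [min_comm, max_comm]
    exact this hj hi hPj hPi hjC hiC hleft.symm hright.symm (le_of_not_ge hij)
  obtain ⟨D, rfl⟩ := Nat.exists_eq_add_of_le hij
  rw [min_eq_left hij, max_eq_right hij, Nat.add_sub_cancel_left]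
  exact ⟨hi, hj, hPi, hjC, hleft, hright⟩

end BranchingPair

open Classical in
/-- The distances of the branching pairs of `x`. -/
noncomputable def pairDistances (T : List α) (P C : ℕ) (x : List α) : Finset ℕ :=
  (Finset.range (C + 1)).filter fun D => ∃ i, BranchingPair T P C x i D

theorem mem_pairDistances : D ∈ pairDistances T P C x ↔ ∃ i, BranchingPair T P C x i D := by
  classical
  refine Finset.mem_filter.trans (and_iff_right_of_imp ?_)
  rintro ⟨i, h⟩
  have := h.right_le
  exact Finset.mem_range.2 (by omega)

end BranchingPairs

theorem exists_ne_and_ne {ι β γ : Type*} {O : ι → Prop} {f : ι → β} {g : ι → γ}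
    (hf : ∃ i j, O i ∧ O j ∧ f i ≠ f j) (hg : ∃ i j, O i ∧ O j ∧ g i ≠ g j) :
    ∃ i j, O i ∧ O j ∧ f i ≠ f j ∧ g i ≠ g j := by
  obtain ⟨i, j, hi, hj, hij⟩ := hf
  obtain ⟨k, l, hk, hl, hkl⟩ := hg
  by_contra! h
  have hconst : ∀ m, O m → g m = g i := by
    intro m hm
    by_cases hmi : f m = f i
    · rw [h m j hm hj (hmi ▸ hij), h i j hi hj hij]
    · exact h m i hm hi hmi
  exact hkl ((hconst k hk).trans (hconst l hl).symm)

section EditPairs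

variable {p c s x : List α} {d : α} {D i : ℕ}

theorem BranchingPair.sub_mem_borders (hs : EndsUniquely d s) (hp : d ∉ p) (hD : c.length ≤ D)
    (h : BranchingPair (p ++ c ++ s) p.length (p.length + c.length) x i D) :
    D - c.length ∈ borders p s := by
  obtain ⟨k, rfl⟩ := Nat.exists_eq_add_of_le' hD
  have hPi := h.le_left
  have hjC := h.right_le
  have hlen : (p.drop (p.length - k)).length = k := by rw [List.length_drop]; omega
  -- Shifting by `D` takes the last `k` letters of `p` to the beginning of `s`.
  have hocc : OccAt (p ++ c ++ s) (p.drop (p.length - k)) (p.length + c.length) := by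
    have hx := h.occ_left.restrict (occAt_drop p c s (Nat.sub_le p.length k)) (by omega) (by omega)
    convert h.occ_right.trans hx using 1
    omega
  have hle := hocc.add_length_le
  have hpre : p.drop (p.length - k) <+: s := prefix_iff_occAt.2 (by
    simpa using (occAt_append_append_right p c s).restrict hocc le_rfl
      (by simpa only [List.length_append] using hle))
  rw [Nat.add_sub_cancel, mem_borders]
  rw [List.prefix_iff_eq_take, hlen] at hpre
  rw [hlen, List.length_append, List.length_append] at hle
  refine ⟨lt_of_le_of_ne (by omega) fun hk => hp ?_, hpre ▸ List.drop_suffix _ _⟩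
  rw [hk, List.take_length] at hpre
  exact List.mem_of_mem_drop (hpre ▸ hs.mem)

theorem sum_card_pairDistances_le_card_borders (hs : EndsUniquely d s) (hp : d ∉ p)
    (hc : c.length ≤ 1) (S : Finset (List α)) :
    ∑ x ∈ S, (pairDistances (p ++ c ++ s) p.length (p.length + c.length) x).card ≤
      (borders p s).card := by
  classical
  rw [← Finset.card_biUnion]
  · refine Finset.card_le_card_of_injOn (fun D => D - c.length) (fun D hD => ?_)
      fun D hD D' hD' h => ?_
    · obtain ⟨x, -, hx⟩ := Finset.mem_biUnion.1 hD
      obtain ⟨i, hi⟩ := mem_pairDistances.1 hx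
      exact hi.sub_mem_borders hs hp (hc.trans hi.pos)
    · obtain ⟨x, -, hx⟩ := Finset.mem_biUnion.1 hD
      obtain ⟨y, -, hy⟩ := Finset.mem_biUnion.1 hD'
      have := (mem_pairDistances.1 hx).choose_spec.pos
      have := (mem_pairDistances.1 hy).choose_spec.pos
      simp only at h
      omega
  · intro x _ y _ hxy
    refine Finset.disjoint_left.2 fun D hx hy => hxy ?_
    obtain ⟨i, hi⟩ := mem_pairDistances.1 hx
    obtain ⟨j, hj⟩ := mem_pairDistances.1 hy
    exact hi.eq_of_dist_eq (by omega) hj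

end EditPairs

/-! ### New letters of substrings that become left-maximal -/

section Window

variable {T x : List α} {P C : ℕ}

theorem card_rightLetters_sub_one_le_card_pairDistances (hC : C ≤ P + 1) (hL : LeftMaximal T x)
    (hwindow : ∀ i, OccAt T x i → P < i + x.length ∧ i < C) :
    (rightLetters T x).card - 1 ≤ (pairDistances T P C x).card := by
  have htwo : (rightLetters T x).card ≤ 2 := card_rightLetters_le_two fun i j hi hj => by
    have := hwindow i hi
    have := hwindow j hj
    omega
  by_cases hone : (rightLetters T x).card ≤ 1
  · omega
  obtain ⟨a, ha, b, hb, hab⟩ := Finset.one_lt_card.1 (not_le.1 hone)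
  simp only [mem_rightLetters, infix_iff_exists_occAt, occAt_concat] at ha hb
  obtain ⟨i, hi, hia⟩ := ha
  obtain ⟨j, hj, hjb⟩ := hb
  have hright : T[i + x.length]? ≠ T[j + x.length]? := by simpa [hia, hjb] using hab
  have hpos : ∃ k, OccAt T x k ∧ k ≠ 0 := by
    by_cases h0 : i = 0
    · exact ⟨j, hj, fun hj0 => hright (by rw [h0, hj0])⟩
    · exact ⟨i, hi, h0⟩
  obtain ⟨k, hk, hk0⟩ := hpos
  obtain ⟨i, j, hi, hj, hleft, hright⟩ :=
    exists_ne_and_ne (g := fun i => T[i + x.length]?) (exists_leftContext_ne hL hk hk0)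
      ⟨i, j, hi, hj, hright⟩
  have hpair : BranchingPair T P C x (min i j) (max i j - min i j) :=
    .of_occAt hi hj (hwindow i hi).1.le (hwindow j hj).1.le (hwindow i hi).2.le
      (hwindow j hj).2.le hleft hright
  have := Finset.card_pos.2 ⟨_, mem_pairDistances.2 ⟨_, hpair⟩⟩
  omega

end Window

section CoveredLetters

variable {T T' x y p b c s : List α} {a d : α} {i k : ℕ}

open Classical in
/-- The new right letters of `x` that follow an occurrence of `x` with a new left context. -/
noncomputable def coveredLetters (T T' x : List α) : Finset α :=
  (newLetters T T' x).filter fun a => ∃ i, LeftNew T T' x i ∧ T'[i + x.length]? = some a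

theorem mem_coveredLetters : a ∈ coveredLetters T T' x ↔
    a ∈ newLetters T T' x ∧ ∃ i, LeftNew T T' x i ∧ T'[i + x.length]? = some a := by
  simp [coveredLetters]

theorem LeftNew.exists_branchingPair (hc : c.length ≤ 1)
    (hi : LeftNew (p ++ b ++ s) (p ++ c ++ s) x i)
    (ha : a ∈ newLetters (p ++ b ++ s) (p ++ c ++ s) x)
    (hcov : a ∉ coveredLetters (p ++ b ++ s) (p ++ c ++ s) x) :
    ∃ j, (p ++ c ++ s)[j + x.length]? = some a ∧
      BranchingPair (p ++ c ++ s) p.length (p.length + c.length) x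
        (min i j) (max i j - min i j) := by
  have hne : ∀ k, LeftNew (p ++ b ++ s) (p ++ c ++ s) x k →
      (p ++ c ++ s)[k + x.length]? ≠ some a :=
    fun k hk hka => hcov (mem_coveredLetters.2 ⟨ha, k, hk, hka⟩)
  obtain ⟨haT', haT⟩ := mem_newLetters.1 ha
  obtain ⟨j, hj⟩ := infix_iff_exists_occAt.1 haT'
  have hjwindow := hj.crosses_of_concat hc haT
  have hiwindow := hi.crosses hc
  obtain ⟨hj, hja⟩ := occAt_concat.1 hj
  exact ⟨j, hja, .of_occAt hi.occAt hj (by omega) (by omega) (by omega) (by omega)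
    (fun h => hne j ⟨hj, h ▸ hi.not_hasLeftContext⟩ hja) (by rw [hja]; exact hne i hi)⟩

theorem card_newLetters_le (hc : c.length ≤ 1) (hx : x <:+: p ++ b ++ s)
    (hL : ¬ LeftMaximal (p ++ b ++ s) x) (hL' : LeftMaximal (p ++ c ++ s) x) :
    (newLetters (p ++ b ++ s) (p ++ c ++ s) x).card ≤
      (coveredLetters (p ++ b ++ s) (p ++ c ++ s) x).card +
        (pairDistances (p ++ c ++ s) p.length (p.length + c.length) x).card := by
  classical
  obtain ⟨i, hi⟩ := exists_leftNew hx hL hL'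
  have hpair := fun a (ha : a ∈ newLetters (p ++ b ++ s) (p ++ c ++ s) x \
      coveredLetters (p ++ b ++ s) (p ++ c ++ s) x) =>
    hi.exists_branchingPair hc (Finset.mem_sdiff.1 ha).1 (Finset.mem_sdiff.1 ha).2
  choose! j hja hpair using hpair
  have huncovered := Finset.card_le_card_of_injOn (fun a => max i (j a) - min i (j a))
    (fun a ha => mem_pairDistances.2 ⟨_, hpair a ha⟩) fun a ha e he hdist => by
      simp only at hdist
      have hmin := (hpair a ha).start_eq (by omega) (hdist ▸ hpair e he)
      have hj : j a = j e := by omega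
      exact Option.some.inj ((hja a ha).symm.trans (hj ▸ hja e he))
  have := Finset.card_le_card_sdiff_add_card
    (s := newLetters (p ++ b ++ s) (p ++ c ++ s) x)
    (t := coveredLetters (p ++ b ++ s) (p ++ c ++ s) x)
  omega

open Classical in
/-- The lengths `k < |s|` such that some occurrence of `x` in `p ++ c ++ s` that ends
after the first `k` letters of `s` has a left context that `x` does not have in `p ++ b ++ s`. -/
noncomputable def leftNewEnds (p b c s x : List α) : Finset ℕ :=
  (Finset.range s.length).filter fun k =>
    ∃ i, LeftNew (p ++ b ++ s) (p ++ c ++ s) x i ∧ i + x.length = p.length + c.length + k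

theorem mem_leftNewEnds : k ∈ leftNewEnds p b c s x ↔ k < s.length ∧
    ∃ i, LeftNew (p ++ b ++ s) (p ++ c ++ s) x i ∧ i + x.length = p.length + c.length + k := by
  simp [leftNewEnds]

theorem LeftNew.exists_mem_leftNewEnds (hc : c.length ≤ 1)
    (hT' : EndsUniquely d (p ++ c ++ s)) (hx : x ≠ []) (hd : d ∉ x)
    (h : LeftNew (p ++ b ++ s) (p ++ c ++ s) x i) :
    ∃ k ∈ leftNewEnds p b c s x, i + x.length = p.length + c.length + k := by
  have hlt : i + x.length < (p ++ c ++ s).length := lt_of_le_of_ne h.occAt.add_length_le fun hi =>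
    hd (hT'.mem_of_suffix (suffix_iff_occAt.2 ⟨i, h.occAt, hi⟩) hx)
  obtain ⟨k, hk⟩ := Nat.exists_eq_add_of_le (h.crosses hc).2
  rw [hk, List.length_append, List.length_append] at hlt
  exact ⟨k, mem_leftNewEnds.2 ⟨by omega, i, h, hk⟩, hk⟩

theorem take_suffix_of_mem_leftNewEnds (hc : c.length ≤ 1) (hk : k ∈ leftNewEnds p b c s x) :
    s.take k <:+ x := by
  obtain ⟨hks, i, hi, hik⟩ := mem_leftNewEnds.1 hk
  have hlen : (s.take k).length = k := List.length_take_of_le hks.le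
  have htake : OccAt (p ++ c ++ s) (s.take k) (p.length + c.length) := by
    simpa using (occAt_append_append_right p c s).trans
      (prefix_iff_occAt.1 (List.take_prefix k s))
  have hCi := (hi.crosses hc).1
  exact suffix_iff_occAt.2 ⟨_, hi.occAt.restrict htake hCi (by omega), by omega⟩

theorem disjoint_leftNewEnds (hx : x <:+: p ++ b ++ s) (hy : y <:+: p ++ b ++ s) (hxy : x ≠ y) :
    Disjoint (leftNewEnds p b c s x) (leftNewEnds p b c s y) := by
  refine Finset.disjoint_left.2 fun k hkx hky => hxy ?_
  obtain ⟨-, i, hi, hik⟩ := mem_leftNewEnds.1 hkx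
  obtain ⟨-, j, hj, hjk⟩ := mem_leftNewEnds.1 hky
  have hyx := hi.length_le hj.occAt hy (by omega)
  have hxy := hj.length_le hi.occAt hx (by omega)
  obtain rfl : i = j := by omega
  exact hi.occAt.eq_of_length_eq hj.occAt (by omega)

theorem take_concat_infix (ha : s[k]? = some a) (hs : s <:+: T) :
    s.take k ++ [a] <:+: T := by
  rw [← Option.toList_some, ← ha, ← List.take_add_one]
  exact (List.take_prefix _ _).isInfix.trans hs

open Classical in
theorem card_rightLetters_add_card_filter_le (hc : c.length ≤ 1)
    (hk : k ∈ leftNewEnds p b c s x) :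
    (rightLetters (p ++ b ++ s) x).card +
        ((newLetters (p ++ b ++ s) (p ++ c ++ s) x).filter fun a => s[k]? = some a).card ≤
      (rightLetters (p ++ b ++ s) (s.take k)).card := by
  rw [← Finset.card_union_of_disjoint (Finset.disjoint_left.2 fun a ha ha' =>
    (mem_newLetters.1 (Finset.mem_filter.1 ha').1).2 (mem_rightLetters.1 ha))]
  refine Finset.card_le_card (Finset.union_subset (fun a ha => ?_) fun a ha => ?_)
  · obtain ⟨t, rfl⟩ := take_suffix_of_mem_leftNewEnds hc hk
    rw [mem_rightLetters, List.append_assoc] at ha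
    exact mem_rightLetters.2 (infix_of_append_infix_right ha)
  · exact mem_rightLetters.2
      (take_concat_infix (Finset.mem_filter.1 ha).2 (infix_append_append_right p b s))

open Classical in
theorem card_coveredLetters_le (hc : c.length ≤ 1) (hT' : EndsUniquely d (p ++ c ++ s))
    (hx : x ≠ []) (hd : d ∉ x) :
    (coveredLetters (p ++ b ++ s) (p ++ c ++ s) x).card ≤ ∑ k ∈ leftNewEnds p b c s x,
      ((newLetters (p ++ b ++ s) (p ++ c ++ s) x).filter fun a => s[k]? = some a).card := by
  refine (Finset.card_le_card fun a ha => ?_).trans Finset.card_biUnion_le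
  obtain ⟨ha, i, hi, hia⟩ := mem_coveredLetters.1 ha
  obtain ⟨k, hk, hik⟩ := hi.exists_mem_leftNewEnds hc hT' hx hd
  rw [hik, (occAt_append_append_right p c s).getElem?_add k (mem_leftNewEnds.1 hk).1] at hia
  exact Finset.mem_biUnion.2 ⟨k, hk, Finset.mem_filter.2 ⟨ha, hia⟩⟩

theorem card_rightLetters_sub_one_add_card_coveredLetters_le (hc : c.length ≤ 1)
    (hT : EndsUniquely d (p ++ b ++ s)) (hT' : EndsUniquely d (p ++ c ++ s))
    (hx : x <:+: p ++ b ++ s) (hL : ¬ LeftMaximal (p ++ b ++ s) x)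
    (hL' : LeftMaximal (p ++ c ++ s) x) (hd : d ∉ x) :
    (rightLetters (p ++ b ++ s) x).card - 1 +
        (coveredLetters (p ++ b ++ s) (p ++ c ++ s) x).card ≤
      ∑ k ∈ leftNewEnds p b c s x, ((rightLetters (p ++ b ++ s) (s.take k)).card - 1) := by
  classical
  have hnil : x ≠ [] := by
    rintro rfl
    exact hL ⟨hx, Or.inr List.nil_prefix⟩
  have hends : 0 < (leftNewEnds p b c s x).card := by
    obtain ⟨i, hi⟩ := exists_leftNew hx hL hL'
    obtain ⟨k, hk, -⟩ := hi.exists_mem_leftNewEnds hc hT' hnil hd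
    exact Finset.card_pos.2 ⟨k, hk⟩
  have hpos := (hT.rightLetters_nonempty hx hd).card_pos
  calc (rightLetters (p ++ b ++ s) x).card - 1 +
        (coveredLetters (p ++ b ++ s) (p ++ c ++ s) x).card
      ≤ (leftNewEnds p b c s x).card * ((rightLetters (p ++ b ++ s) x).card - 1) +
        ∑ k ∈ leftNewEnds p b c s x, ((newLetters (p ++ b ++ s) (p ++ c ++ s) x).filter
          fun a => s[k]? = some a).card :=
        Nat.add_le_add (Nat.le_mul_of_pos_left _ hends) (card_coveredLetters_le hc hT' hnil hd)
    _ = ∑ k ∈ leftNewEnds p b c s x, ((rightLetters (p ++ b ++ s) x).card - 1 +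
        ((newLetters (p ++ b ++ s) (p ++ c ++ s) x).filter fun a => s[k]? = some a).card) := by
        rw [Finset.sum_add_distrib, Finset.sum_const, smul_eq_mul]
    _ ≤ _ := Finset.sum_le_sum fun k hk => by
        have := card_rightLetters_add_card_filter_le hc hk
        omega

theorem sum_card_coveredLetters_le_excess (hc : c.length ≤ 1)
    (hT : EndsUniquely d (p ++ b ++ s)) (hT' : EndsUniquely d (p ++ c ++ s))
    (S : Finset (List α)) (hS : ∀ x ∈ S, x <:+: p ++ b ++ s)
    (hL : ∀ x ∈ S, ¬ LeftMaximal (p ++ b ++ s) x) (hL' : ∀ x ∈ S, LeftMaximal (p ++ c ++ s) x)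
    (hd : ∀ x ∈ S, d ∉ x) :
    ∑ x ∈ S, ((rightLetters (p ++ b ++ s) x).card - 1 +
        (coveredLetters (p ++ b ++ s) (p ++ c ++ s) x).card) ≤ excess (p ++ b ++ s) := by
  classical
  calc _ ≤ ∑ x ∈ S, ∑ k ∈ leftNewEnds p b c s x,
          ((rightLetters (p ++ b ++ s) (s.take k)).card - 1) :=
        Finset.sum_le_sum fun x hx => card_rightLetters_sub_one_add_card_coveredLetters_le hc hT
          hT' (hS x hx) (hL x hx) (hL' x hx) (hd x hx)
    _ = ∑ k ∈ S.biUnion (leftNewEnds p b c s),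
          ((rightLetters (p ++ b ++ s) (s.take k)).card - 1) :=
        (Finset.sum_biUnion fun x hx y hy hxy =>
          disjoint_leftNewEnds (hS x hx) (hS y hy) hxy).symm
    _ ≤ ∑ k ∈ Finset.range s.length, ((rightLetters (p ++ b ++ s) (s.take k)).card - 1) :=
        Finset.sum_le_sum_of_subset (Finset.biUnion_subset.2 fun x _ => Finset.filter_subset _ _)
    _ ≤ excess (p ++ b ++ s) :=
        sum_card_rightLetters_take_le_excess (infix_append_append_right p b s)

end CoveredLetters

/-! ### The excess of the edited string -/

section Edit

variable {p b c s x : List α} {d : α}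

open Classical in
theorem card_rightLetters_sub_one_le (hc : c.length ≤ 1) (hT : EndsUniquely d (p ++ b ++ s))
    (hL' : LeftMaximal (p ++ c ++ s) x) (hd : d ∉ x) :
    (rightLetters (p ++ c ++ s) x).card - 1 ≤
      (if MaximalSubstring (p ++ b ++ s) x then (rightLetters (p ++ b ++ s) x).card - 1 else 0) +
      (if LeftMaximal (p ++ b ++ s) x then
        (newLetters (p ++ b ++ s) (p ++ c ++ s) x).card else 0) +
      (if x <:+: p ++ b ++ s ∧ ¬ LeftMaximal (p ++ b ++ s) x then
        (rightLetters (p ++ b ++ s) x).card - 1 +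
          (coveredLetters (p ++ b ++ s) (p ++ c ++ s) x).card else 0) +
      (pairDistances (p ++ c ++ s) p.length (p.length + c.length) x).card := by
  have hle := card_rightLetters_le_add_card_newLetters (p ++ b ++ s) (p ++ c ++ s) x
  by_cases hx : x <:+: p ++ b ++ s
  · have hpos := (hT.rightLetters_nonempty hx hd).card_pos
    by_cases hL : LeftMaximal (p ++ b ++ s) x
    · rw [if_pos hL]
      by_cases hR : RightMaximal (p ++ b ++ s) x
      · rw [if_pos ⟨hL, hR⟩]
        omega
      · have := mt rightMaximal_of_two_le_card hR
        omega
    · rw [if_pos (⟨hx, hL⟩ : _ ∧ _)]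
      have := card_newLetters_le hc hx hL hL'
      omega
  · exact le_add_left (card_rightLetters_sub_one_le_card_pairDistances (by omega) hL'
      fun i hi => (hi.crosses hx).symm)

theorem sum_card_rightLetters_sub_one_le_excess {T : List α} (hT : EndsUniquely d T)
    (S : Finset (List α)) (hS : ∀ x ∈ S, MaximalSubstring T x) (hd : ∀ x ∈ S, d ∉ x) :
    ∑ x ∈ S, ((rightLetters T x).card - 1) ≤ excess T := by
  classical
  refine Finset.sum_le_sum_of_subset fun x hx =>
    Finset.mem_erase.2 ⟨?_, mem_nodeFinset.2 (hS x hx)⟩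
  rintro rfl
  exact hd x hx hT.mem

theorem excess_le_two_mul_size (hc : c.length ≤ 1) (hs : s ≠ [])
    (hT : EndsUniquely d (p ++ b ++ s)) (hT' : EndsUniquely d (p ++ c ++ s)) :
    excess (p ++ c ++ s) ≤ 2 * size (p ++ b ++ s) + 2 := by
  classical
  have hp : d ∉ p := fun hd => hs (List.append_eq_nil_iff.1
    ((List.append_assoc p b s ▸ hT).eq_nil_of_append hd)).2
  set V := (nodeFinset (p ++ c ++ s)).erase (p ++ c ++ s) with hV
  have hleft : ∀ x ∈ V, LeftMaximal (p ++ c ++ s) x := fun x hx =>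
    (mem_nodeFinset.1 (Finset.mem_of_mem_erase hx)).1
  have hd : ∀ x ∈ V, d ∉ x := fun x hx => notMem_of_mem_nodeFinset_erase hT' hx
  have hterm := Finset.sum_le_sum fun x hx =>
    card_rightLetters_sub_one_le hc hT (hleft x hx) (hd x hx)
  rw [Finset.sum_add_distrib, Finset.sum_add_distrib, Finset.sum_add_distrib,
    ← Finset.sum_filter, ← Finset.sum_filter, ← Finset.sum_filter] at hterm
  have hold := sum_card_rightLetters_sub_one_le_excess hT
    (V.filter fun x => MaximalSubstring (p ++ b ++ s) x)
    (fun x hx => (Finset.mem_filter.1 hx).2) fun x hx => hd x (Finset.mem_filter.1 hx).1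
  have hnew := sum_card_newLetters_le_card_nodeFinset hc
    (V.filter fun x => LeftMaximal (p ++ b ++ s) x) fun x hx => (Finset.mem_filter.1 hx).2
  have hcovered := sum_card_coveredLetters_le_excess hc hT hT'
    (V.filter fun x => x <:+: p ++ b ++ s ∧ ¬ LeftMaximal (p ++ b ++ s) x)
    (fun x hx => (Finset.mem_filter.1 hx).2.1) (fun x hx => (Finset.mem_filter.1 hx).2.2)
    (fun x hx => hleft x (Finset.mem_filter.1 hx).1) fun x hx => hd x (Finset.mem_filter.1 hx).1
  have hpairs := sum_card_pairDistances_le_card_borders (hT.of_append hs) hp hc V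
  have hborders := card_borders_le (hT.of_append hs) (infix_append_append_right p b s) p
  have hbranching := card_branchingPrefixes_lt (infix_append_append_right p b s)
  have hexcess := excess_add_card_nodeFinset hT
  rw [excess, ← hV]
  omega

theorem exists_append_append_ne_nil (hc : c.length ≤ 1)
    (hT : EndsUniquely d (p ++ b ++ s)) (hT' : EndsUniquely d (p ++ c ++ s)) :
    ∃ q e f t : List α, f.length ≤ 1 ∧ t ≠ [] ∧ p ++ b ++ s = q ++ e ++ t ∧
      p ++ c ++ s = q ++ f ++ t := by
  rcases eq_or_ne s [] with rfl | hs
  · rw [List.append_nil] at hT hT'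
    rcases eq_or_ne c [] with rfl | hcne
    · rw [List.append_nil] at hT'
      obtain rfl := hT.eq_nil_of_append hT'.mem
      obtain ⟨u, -, rfl⟩ := hT'
      exact ⟨u, [], [], [d], by simp⟩
    · have hbne : b ≠ [] := by
        rintro rfl
        exact hcne (hT'.eq_nil_of_append (by simpa using hT.mem))
      obtain ⟨e, -, rfl⟩ := hT.of_append hbne
      obtain ⟨f, -, rfl⟩ := hT'.of_append hcne
      exact ⟨p, e, f, [d], by simp at hc; simp [hc]⟩
  · exact ⟨p, b, c, s, hc, hs, rfl, rfl⟩

theorem SingleEdit.exists_append {T T' : List α} (h : SingleEdit T T') :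
    ∃ p b c s, c.length ≤ 1 ∧ T = p ++ b ++ s ∧ T' = p ++ c ++ s := by
  cases h with
  | insertion p s a => exact ⟨p, [], [a], s, by simp⟩
  | deletion p s a => exact ⟨p, [a], [], s, by simp⟩
  | substitution p s a b hab => exact ⟨p, [a], [b], s, by simp⟩

end Edit

end CDAWG

theorem mainTheorem1_general {α : Type*} (d : α) (p b c s : List α) (hc : c.length ≤ 1)
    (hT : CDAWG.EndsUniquely d (p ++ b ++ s)) (hT' : CDAWG.EndsUniquely d (p ++ c ++ s)) :
    CDAWG.gsize (p ++ c ++ s) ≤ 4 * CDAWG.size (p ++ b ++ s) + 4 := by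
  obtain ⟨q, e, f, t, hf, ht, hqT, hqT'⟩ := CDAWG.exists_append_append_ne_nil hc hT hT'
  rw [hqT] at hT ⊢
  rw [hqT'] at hT' ⊢
  have hgsize := CDAWG.gsize_le_two_mul_excess hT'
  have hexcess := CDAWG.excess_le_two_mul_size hf ht hT hT'
  omega

theorem mainTheorem1 {α : Type*} (d : α) (T T' : List α)
    (hT : CDAWG.EndsUniquely d T) (hT' : CDAWG.EndsUniquely d T')
    (hedit : CDAWG.SingleEdit T T') :
    (CDAWG.gsize T' : ℤ) - (CDAWG.gsize T : ℤ) ≤ 4 * (CDAWG.size T : ℤ) + 4 := by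
  obtain ⟨p, b, c, s, hc, rfl, rfl⟩ := hedit.exists_append
  have := mainTheorem1_general d p b c s hc hT hT'
  omega
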